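/- A partition $\lambda=(\lambda_1\ge\lambda_2\ge\cdots\ge\lambda_\ell>0)$ has $\ell(\lambda)=\ell$ parts and size $|\lambda|=\sum_i\lambda_i$; put $\lambda_{\ell+1}=0$ (and $\lambda_1=0$ for the empty partition). It is $2$-restricted if $\lambda_i-\lambda_{i+1}<2$ for $1\le i\le \ell(\lambda)$. For $a\in\{1,2\}$ let $(t_1,t_2)=(0,1)$ if $a=1$ and $(t_1,t_2)=(0,0)$ if $a=2$. Let $\Lambda^{a,2}(n)$ be the set of pairs $\mu=(\mu^{(1)},\mu^{(2)})$ of $2$-restricted partitions with $|\mu^{(1)}|+|\mu^{(2)}|=n$ and $\ell(\mu^{(1)})+t_1\le \mu^{(2)}_1+t_2$. The residue of the node in row $i$ and column $j$ of the Young diagram of $\mu^{(s)}$ is $(j-i+t_s) \bmod 2$, and $\omega(\mu)=C_0(\mu)-C_1(\mu)$, where $C_r(\mu)$ is the number of nodes of $\mu$ (in both components) of residue $r$. Theorem. As formal power series in $x$ whose coefficients are Laurent polynomials in $y$ (all infinite products below being convergent), $$\sum_{n\ge 0}\ \sum_{\mu\in\Lambda^{1,2}(n)} y^{\omega(\mu)}x^n=\prod_{n\ge1}\frac{1+x^{2n}}{1-x^{2n}}\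 \prod_{n\ge1}(1+yx^{2n-1})(1+y^{-1}x^{2n-1})(1-x^{2n})$$ and $$\begin{aligned}\sum_{n\ge 0}\ \sum_{\mu\in\Lambda^{2,2}(n)} y^{\omega(\mu)}x^n=\frac12\Bigg(&\prod_{n\ge1}\frac{1+x^{2n-1}}{1-x^{2n}}\ \prod_{n\ge1}(1+yx^{2n-2})(1+y^{-1}x^{2n})(1-x^{2n})\\&+\prod_{n\ge1}\frac{1-x^{2n-1}}{1-x^{2n}}\ \prod_{n\ge1}(1-yx^{2n-2})(1-y^{-1}x^{2n})(1-x^{2n})\Bigg).\end{aligned}$$ -/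

import Mathlib

open scoped LaurentPolynomial PowerSeries PowerSeries.WithPiTopology

namespace ArikiKoike

/-- A partition is represented by its Young diagram `μ` (rows and columns are indexed from `0`):
the `(i+1)`-st part is `μ.rowLen i`, the number of parts is `μ.colLen 0`, the size is `μ.card`.
`μ` is `e`-restricted if consecutive parts (the part after the last one being `0`)
differ by less than `e`. -/
def IsRestricted (e : ℕ) (μ : YoungDiagram) : Prop :=
  ∀ i < μ.colLen 0, μ.rowLen i < μ.rowLen (i + 1) + e

/-- An `m`-multipartition is an `m`-tuple of partitions. -/
abbrev Multipartition (m : ℕ) : Type := Fin m → YoungDiagram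

/-- The size of a multipartition. -/
def Multipartition.size {m : ℕ} (μ : Multipartition m) : ℕ := ∑ s, (μ s).card

/-- `(e, t)`-restricted multipartitions: each component is `e`-restricted, and the number of parts
of the `s`-th component plus `t_s` is at most the largest part of the next component
plus `t_{s+1}`. -/
def Multipartition.IsRestricted {m : ℕ} (e : ℕ) (t : Fin m → ℕ) (μ : Multipartition m) : Prop :=
  (∀ s, ArikiKoike.IsRestricted e (μ s)) ∧
    ∀ s s' : Fin m, (s' : ℕ) = s + 1 → (μ s).colLen 0 + t s ≤ (μ s').rowLen 0 + t s'

/-- The Young diagram of a multipartition: the nodes `(i, j)` of the `s`-th component,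
for all `s`. -/
def Multipartition.nodes {m : ℕ} (μ : Multipartition m) : Finset (Σ _ : Fin m, ℕ × ℕ) :=
  Finset.univ.sigma fun s => (μ s).cells

/-- The `p`-residue `j - i + t_s mod p` of a node in row `i` and column `j` of the `s`-th
component. (Counting rows and columns from `0` instead of `1` does not change `j - i`.) -/
def residue {m : ℕ} (p : ℕ) (t : Fin m → ℕ) (x : Σ _ : Fin m, ℕ × ℕ) : ZMod p :=
  (x.2.2 : ZMod p) - (x.2.1 : ZMod p) + (t x.1 : ZMod p)

/-- The number of nodes whose `2`-residue is `r`. -/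
def residueCount {m : ℕ} (t : Fin m → ℕ) (r : ZMod 2) (μ : Multipartition m) : ℕ :=
  (μ.nodes.filter fun x => residue 2 t x = r).card

/-- The sequence `t_1 = ⋯ = t_a = 0`, `t_{a+1} = ⋯ = t_m = 1`. -/
def charge (a m : ℕ) : Fin m → ℕ := fun s => if (s : ℕ) < a then 0 else 1

/-- The `2`-residue statistic `ω = C_0 - C_1`. -/
def omega (a : ℕ) {m : ℕ} (μ : Multipartition m) : ℤ :=
  (residueCount (charge a m) 0 μ : ℤ) - (residueCount (charge a m) 1 μ : ℤ)

/-- `Λ^{a,m}(n)`: the `(2, t)`-restricted `m`-multipartitions of `n`. -/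
def LambdaSet (a m n : ℕ) : Set (Multipartition m) :=
  {μ | μ.IsRestricted 2 (charge a m) ∧ μ.size = n}

theorem mem_square_of_card_le {μ : YoungDiagram} {n : ℕ} (h : μ.card ≤ n) :
    μ.cells ⊆ Finset.range n ×ˢ Finset.range n := by
  rintro ⟨i, j⟩ hij
  have hsub : Finset.range (i + 1) ×ˢ Finset.range (j + 1) ⊆ μ.cells := by
    rintro ⟨k, l⟩ hkl
    simp only [Finset.mem_product, Finset.mem_range] at hkl
    exact μ.up_left_mem (Nat.lt_succ_iff.mp hkl.1) (Nat.lt_succ_iff.mp hkl.2) hij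
  have hcard := (Finset.card_le_card hsub).trans h
  simp only [Finset.card_product, Finset.card_range] at hcard
  simp only [Finset.mem_product, Finset.mem_range]
  constructor <;> nlinarith

theorem finite_card_le (n : ℕ) : {μ : YoungDiagram | μ.card ≤ n}.Finite := by
  refine Set.Finite.of_finite_image (f := YoungDiagram.cells) ?_ ?_
  · refine (Finset.finite_toSet (Finset.range n ×ˢ Finset.range n).powerset).subset ?_
    rintro _ ⟨μ, hμ, rfl⟩
    exact Finset.mem_coe.2 (Finset.mem_powerset.2 (mem_square_of_card_le hμ))
  · intro μ _ ν _ h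
    exact YoungDiagram.ext h

theorem LambdaSet_finite (a m n : ℕ) : (LambdaSet a m n).Finite := by
  refine (Set.Finite.pi' fun _ : Fin m => finite_card_le n).subset ?_
  intro μ hμ s
  have h : (μ s).card ≤ ∑ s, (μ s).card :=
    Finset.single_le_sum (f := fun s => (μ s).card) (fun _ _ => Nat.zero_le _) (Finset.mem_univ s)
  exact h.trans hμ.2.le

/-- `Λ^{a,m}(n)` as a finite set. -/
noncomputable def Lambda (a m n : ℕ) : Finset (Multipartition m) :=
  (LambdaSet_finite a m n).toFinset

/-- The bivariate generating function `∑_n ∑_{μ ∈ Λ^{a,m}(n)} y^{ω(μ)} x^n`, a formal power series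
in `x` whose coefficients are Laurent polynomials in `y`. -/
noncomputable def genFun (a m : ℕ) : ℚ[T;T⁻¹]⟦X⟧ :=
  PowerSeries.mk fun n => ∑ μ ∈ Lambda a m n, LaurentPolynomial.T (omega a μ)

/-- The variable `x`. -/
noncomputable def x : ℚ[T;T⁻¹]⟦X⟧ := PowerSeries.X

/-- The variable `y`. -/
noncomputable def y : ℚ[T;T⁻¹]⟦X⟧ := PowerSeries.C (LaurentPolynomial.T 1)

/-- The inverse `y⁻¹`. -/
noncomputable def yInv : ℚ[T;T⁻¹]⟦X⟧ := PowerSeries.C (LaurentPolynomial.T (-1))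

/-- The series `1 / f`, for a power series `f` with constant coefficient `1`. -/
noncomputable def recip (f : ℚ[T;T⁻¹]⟦X⟧) : ℚ[T;T⁻¹]⟦X⟧ := PowerSeries.invOfUnit f 1

theorem y_mul_yInv : y * yInv = 1 := by
  rw [y, yInv, ← map_mul, ← LaurentPolynomial.T_add]
  simp

theorem mul_recip (n : ℕ) : (1 - x ^ (2 * n + 2)) * recip (1 - x ^ (2 * n + 2)) = 1 :=
  PowerSeries.mul_invOfUnit _ 1 (by simp [x])

end ArikiKoike

namespace ArikiKoike

open Finset.HasAntidiagonal (antidiagonal)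
open PowerSeries (X)

/-! ### Formal q-series: Pochhammer symbols and Euler's product expansion. -/

section QSeries

variable {A : Type*} [CommRing A]

/-! Transposing a `2`-restricted partition gives a strict partition, listed by its column lengths.
Residues alternate down a column, so each column contributes its parity up to sign, and `ω` becomes
an alternating sum of column parities (`isRestricted_two_iff`, `omega_eq`). The linking condition
bounds the parts of the first strict partition by the number `k` of parts of the second, plus `0` or
`1`. Hence the generating function is a sum over `k` of `boundedGen` times `lengthGen`
(`hasSum_boundedGen_mul_lengthGen`).

Both factors are Gaussian-binomial sums in base `q = X ^ 2` (`X_pow_mul_boundedGen`,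
`lengthGen_eq`). Expanding one product by q-Vandermonde gives a sum over quadruples `(u, v, r, s)`.
The exponent of `y` depends only on `u - v` and on a parity. That parity is resolved by averaging
over `t = ±1`, which produces the factor `1/2`. The sums over `r` and `s` are Euler series, so a
double series in `(u, v)` remains.

For `a = 2`, the Euler factors turn `1 / (q; q)` into `1 / (P; P)` with `P = -(tX)`, and the double
series runs over index pairs of opposite parity (`tsum_caseTwo`). For `a = 1`, symmetrizing in `u`
and `v` kills `t = -1` and changes the base to `q ^ 2` for `t = 1` (`tsum_symm`,
`tsum_symmTerm_one`). In both cases Cauchy's identity collapses the double series to a theta series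
(`hasSum_bilateral`), which Jacobi's triple product factors. -/

theorem eq_of_forall_X_pow_dvd_sub {f g : A⟦X⟧} (h : ∀ n, (X : A⟦X⟧) ^ n ∣ f - g) :
    f = g := by
  ext n
  have := PowerSeries.X_pow_dvd_iff.1 (h (n + 1)) n (Nat.lt_succ_self n)
  rwa [map_sub, sub_eq_zero] at this

theorem tendsto_of_X_pow_dvd_sub [TopologicalSpace A] {f : ℕ → A⟦X⟧} {g : A⟦X⟧}
    (h : ∀ n, (X : A⟦X⟧) ^ n ∣ f n - g) :
    Filter.Tendsto f Filter.atTop (nhds g) := by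
  rw [PowerSeries.WithPiTopology.tendsto_iff_coeff_tendsto]
  intro d
  refine tendsto_atTop_of_eventually_const (i₀ := d + 1) fun n hn => ?_
  have := PowerSeries.X_pow_dvd_iff.1 (h n) d (by lia)
  rwa [map_sub, sub_eq_zero] at this

theorem summable_of_finite_not_X_pow_dvd [TopologicalSpace A] {ι : Type*} {f : ι → A⟦X⟧}
    (h : ∀ n, {i | ¬ (X : A⟦X⟧) ^ n ∣ f i}.Finite) : Summable f := by
  rw [PowerSeries.WithPiTopology.summable_iff_summable_coeff]
  intro n
  refine summable_of_hasFiniteSupport ((h (n + 1)).subset ?_)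
  intro i hi hdvd
  exact hi (PowerSeries.X_pow_dvd_iff.1 hdvd n (Nat.lt_succ_self n))

/-- A family divisible by powers of `X` whose exponents tend to infinity is summable. -/
theorem summable_of_X_pow_dvd [TopologicalSpace A] {ι : Type*} {f : ι → A⟦X⟧} (d : ι → ℕ)
    (hd : ∀ n, {i | d i < n}.Finite) (h : ∀ i, (X : A⟦X⟧) ^ d i ∣ f i) :
    Summable f := by
  refine summable_of_finite_not_X_pow_dvd fun n => (hd n).subset fun i hi => ?_
  by_contra hn
  exact hi ((pow_dvd_pow _ (not_lt.1 hn)).trans (h i))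

theorem summable_nat_of_X_pow_dvd [TopologicalSpace A] {f : ℕ → A⟦X⟧}
    (h : ∀ i, (X : A⟦X⟧) ^ i ∣ f (i + 1)) : Summable f := by
  refine summable_of_X_pow_dvd (fun i => i - 1)
    (fun n => (Set.finite_Iic n).subset fun i hi => ?_) fun i => ?_
  · simp only [Set.mem_ofPred_eq, Set.mem_Iic] at *
    lia
  · cases i with
    | zero => simp
    | succ i => simpa using h i

section Topology

variable [TopologicalSpace A] [DiscreteTopology A]

theorem X_pow_dvd_of_hasSum {ι : Type*} {f : ι → A⟦X⟧} {s : A⟦X⟧} (hs : HasSum f s) {n : ℕ}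
    (h : ∀ i, (X : A⟦X⟧) ^ n ∣ f i) : (X : A⟦X⟧) ^ n ∣ s := by
  rw [PowerSeries.X_pow_dvd_iff]
  intro m hm
  have h1 := (PowerSeries.WithPiTopology.hasSum_iff_hasSum_coeff A).1 hs m
  have h2 : (fun i => PowerSeries.coeff m (f i)) = fun _ => 0 :=
    funext fun i => PowerSeries.X_pow_dvd_iff.1 (h i) m hm
  rw [h2] at h1
  exact h1.unique hasSum_zero

/-- Summing a summable family along the finite fibres of a map. -/
theorem hasSum_sum_fiber {α β : Type*} {f : α → A⟦X⟧} {S : A⟦X⟧} (hf : HasSum f S) (g : α → β)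
    (s : β → Finset α) (hs : ∀ a b, a ∈ s b ↔ g a = b) :
    HasSum (fun b => ∑ a ∈ s b, f a) S := by
  have h1 := ((Equiv.sigmaFiberEquiv g).hasSum_iff).2 hf
  refine h1.sigma fun b => ?_
  have h2 : HasSum (fun a : {a // a ∈ s b} => f a) (∑ a ∈ s b, f a) := (s b).hasSum f
  exact ((Equiv.subtypeEquivRight fun a => (hs a b).symm : {a // g a = b} ≃ {a // a ∈ s b}).hasSum_iff).2 h2

theorem hasSum_sum_antidiagonal {f : ℕ × ℕ → A⟦X⟧} {S : A⟦X⟧} (hf : HasSum f S) :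
    HasSum (fun n => ∑ ab ∈ antidiagonal n, f ab) S :=
  hasSum_sum_fiber hf (fun ab => ab.1 + ab.2) _ fun _ _ =>
    Finset.HasAntidiagonal.mem_antidiagonal

end Topology

/-- The finite product `(p; p)_n`. -/
noncomputable def qfac (p : A⟦X⟧) (n : ℕ) : A⟦X⟧ := ∏ i ∈ Finset.range n, (1 - p ^ (i + 1))

/-- The series `1 / (p; p)_n`. -/
noncomputable def qfacInv (p : A⟦X⟧) (n : ℕ) : A⟦X⟧ := PowerSeries.invOfUnit (qfac p n) 1

theorem qfac_succ (p : A⟦X⟧) (n : ℕ) : qfac p (n + 1) = qfac p n * (1 - p ^ (n + 1)) :=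
  Finset.prod_range_succ _ _

variable {p : A⟦X⟧}

theorem qfac_mul_qfacInv (hp : X ∣ p) (n : ℕ) : qfac p n * qfacInv p n = 1 := by
  refine PowerSeries.mul_invOfUnit _ 1 ?_
  have h0 : PowerSeries.constantCoeff p = 0 := PowerSeries.X_dvd_iff.1 hp
  simp [qfac, map_prod, h0]

theorem qfacInv_zero (hp : X ∣ p) : qfacInv p 0 = 1 := by
  simpa [qfac] using qfac_mul_qfacInv hp 0

theorem eq_qfacInv (hp : X ∣ p) {n : ℕ} {f : A⟦X⟧} (h : qfac p n * f = 1) :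
    f = qfacInv p n := by
  linear_combination (-f) * qfac_mul_qfacInv hp n + qfacInv p n * h

theorem one_sub_mul_qfacInv_succ (hp : X ∣ p) (n : ℕ) :
    (1 - p ^ (n + 1)) * qfacInv p (n + 1) = qfacInv p n :=
  eq_qfacInv hp (by rw [← mul_assoc, ← qfac_succ, qfac_mul_qfacInv hp])

section Euler

theorem X_pow_dvd_pow (hp : X ∣ p) {n m : ℕ} (h : n ≤ m) :
    (X : A⟦X⟧) ^ n ∣ p ^ m :=
  (pow_dvd_pow _ h).trans (pow_dvd_pow_of_dvd hp m)

theorem choose_two_succ (n : ℕ) : (n + 1).choose 2 = n.choose 2 + n := by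
  rw [Nat.choose_succ_succ' n 1, Nat.choose_one_right, add_comm]

theorem two_mul_choose_two (r : ℕ) : 2 * r.choose 2 + r = r * r := by
  induction r with
  | zero => rfl
  | succ r ih => rw [choose_two_succ]; nlinarith

theorem le_choose_two_succ (n : ℕ) : n ≤ (n + 1).choose 2 := by
  rw [choose_two_succ]; lia

variable [TopologicalSpace A]

/-- Euler's series `∑ p ^ (n choose 2) z ^ n / (p; p)_n`. -/
noncomputable def eulerSeries (p z : A⟦X⟧) : A⟦X⟧ :=
  ∑' n, p ^ n.choose 2 * z ^ n * qfacInv p n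

theorem summable_eulerSeries (hp : X ∣ p) (z : A⟦X⟧) :
    Summable fun n => p ^ n.choose 2 * z ^ n * qfacInv p n :=
  summable_nat_of_X_pow_dvd fun i => Dvd.dvd.mul_right
    (Dvd.dvd.mul_right (X_pow_dvd_pow hp (le_choose_two_succ i)) _) _

theorem multipliable_one_add_of_X_pow_dvd {f : ℕ → A⟦X⟧} (hf : ∀ n, X ^ n ∣ f n) :
    Multipliable fun n => 1 + f n := by
  refine PowerSeries.WithPiTopology.multipliable_one_add_of_tendsto_order_atTop_nhds_top A ?_
  refine ENat.tendsto_nhds_top_iff_natCast_lt.mpr fun n =>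
    Filter.eventually_atTop.mpr ⟨n + 1, fun m hm => ?_⟩
  refine lt_of_lt_of_le (b := ((n + 1 : ℕ) : ℕ∞)) (by exact_mod_cast Nat.lt_succ_self n) ?_
  exact PowerSeries.nat_le_order _ _
    (PowerSeries.X_pow_dvd_iff.1 ((pow_dvd_pow _ hm).trans (hf m)))

theorem multipliable_one_add_mul_pow (hp : X ∣ p) (z : A⟦X⟧) :
    Multipliable fun n => 1 + z * p ^ n :=
  multipliable_one_add_of_X_pow_dvd fun _ => Dvd.dvd.mul_left (X_pow_dvd_pow hp le_rfl) _

theorem hasSum_eulerSeries (hp : X ∣ p) (z : A⟦X⟧) :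
    HasSum (fun n => p ^ n.choose 2 * z ^ n * qfacInv p n) (eulerSeries p z) :=
  (summable_eulerSeries hp z).hasSum

variable [DiscreteTopology A]

/-- In the difference of the series at `z` and `z * p`, the factor `1 - p ^ (n + 1)` cancels the
last factor of the denominator and shifts the index by one. -/
theorem eulerSeries_eq (hp : X ∣ p) (z : A⟦X⟧) :
    eulerSeries p z = (1 + z) * eulerSeries p (z * p) := by
  have h1 := (hasSum_eulerSeries hp z).sub (hasSum_eulerSeries hp (z * p))
  have h2 := (hasSum_eulerSeries hp (z * p)).mul_left z
  rw [hasSum_nat_add_iff' 1 |>.symm] at h1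
  simp only [Finset.range_one, Finset.sum_singleton, Nat.choose_zero_succ, pow_zero, sub_self,
    sub_zero] at h1
  have h3 : (fun n => p ^ (n + 1).choose 2 * z ^ (n + 1) * qfacInv p (n + 1) -
      p ^ (n + 1).choose 2 * (z * p) ^ (n + 1) * qfacInv p (n + 1)) =
      fun n => z * (p ^ n.choose 2 * (z * p) ^ n * qfacInv p n) := by
    funext n
    rw [← one_sub_mul_qfacInv_succ hp n, choose_two_succ]
    ring
  rw [h3] at h1
  linear_combination h1.unique h2

theorem eulerSeries_eq_prod_mul (hp : X ∣ p) (z : A⟦X⟧) (n : ℕ) :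
    eulerSeries p z = (∏ i ∈ Finset.range n, (1 + z * p ^ i)) * eulerSeries p (z * p ^ n) := by
  induction n with
  | zero => simp
  | succ n ih => rw [ih, eulerSeries_eq hp, Finset.prod_range_succ]; ring_nf

theorem X_pow_dvd_eulerSeries_sub_one (hp : X ∣ p) {z : A⟦X⟧} {n : ℕ}
    (hz : X ^ n ∣ z) : X ^ n ∣ eulerSeries p z - 1 := by
  have h1 := hasSum_eulerSeries hp z
  rw [hasSum_nat_add_iff' 1 |>.symm] at h1
  simp only [Finset.range_one, Finset.sum_singleton, Nat.choose_zero_succ, pow_zero, 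
    qfacInv_zero hp, mul_one] at h1
  refine X_pow_dvd_of_hasSum h1 fun i => Dvd.dvd.mul_right (Dvd.dvd.mul_left ?_ _) _
  exact hz.trans (dvd_pow_self _ (Nat.succ_ne_zero i))

/-- Iterating the functional equation leaves a partial product times `eulerSeries p (z * p ^ n)`,
which tends to `1`. -/
theorem hasProd_one_add_mul_pow (hp : X ∣ p) (z : A⟦X⟧) :
    HasProd (fun n => 1 + z * p ^ n) (eulerSeries p z) := by
  have h1 := (multipliable_one_add_mul_pow hp z).hasProd
  have h2 := h1.tendsto_prod_nat
  have h3 : Filter.Tendsto (fun n => (∏ i ∈ Finset.range n, (1 + z * p ^ i)) *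
      eulerSeries p (z * p ^ n)) Filter.atTop (nhds ((∏' n, (1 + z * p ^ n)) * 1)) :=
    h2.mul (tendsto_of_X_pow_dvd_sub fun n => X_pow_dvd_eulerSeries_sub_one hp
      (Dvd.dvd.mul_left (X_pow_dvd_pow hp le_rfl) _))
  simp only [← eulerSeries_eq_prod_mul hp] at h3
  rw [mul_one] at h3
  rwa [tendsto_nhds_unique tendsto_const_nhds h3]

end Euler

end QSeries

/-! ### Cauchy's identity and bilateral series. -/

section Cauchy

variable {A : Type*} [CommRing A] {p : A⟦X⟧} [TopologicalSpace A]

theorem summable_cauchy (hp : X ∣ p) (d k : ℕ) :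
    Summable fun l => p ^ (l * (l + d)) * qfacInv p l * qfacInv p (l + k) :=
  summable_of_X_pow_dvd id (fun n => Set.finite_Iio n) fun l =>
    Dvd.dvd.mul_right (Dvd.dvd.mul_right (X_pow_dvd_pow hp (by
      rcases l with _ | l
      · simp
      · exact Nat.le_mul_of_pos_right _ (by lia))) _) _

/-- Cauchy's series `∑ p ^ (l (l + d)) / ((p; p)_l (p; p)_{l + d})`. -/
noncomputable def cauchySeries (p : A⟦X⟧) (d : ℕ) : A⟦X⟧ :=
  ∑' l, p ^ (l * (l + d)) * qfacInv p l * qfacInv p (l + d)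

theorem hasSum_cauchySeries (hp : X ∣ p) (d : ℕ) :
    HasSum (fun l => p ^ (l * (l + d)) * qfacInv p l * qfacInv p (l + d)) (cauchySeries p d) :=
  (summable_cauchy hp d d).hasSum

variable [DiscreteTopology A]

/-- A contraction: each difference of consecutive series is the next difference times a positive
power of `p`, so all differences vanish X-adically. -/
theorem cauchySeries_sub_succ (hp : X ∣ p) (d : ℕ) :
    cauchySeries p d - cauchySeries p (d + 1) =
      -p ^ (d + 1) * (cauchySeries p (d + 1) - cauchySeries p (d + 2)) := by
  have h0 := hasSum_cauchySeries hp d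
  have h1 := hasSum_cauchySeries hp (d + 1)
  have h2 := hasSum_cauchySeries hp (d + 2)
  -- the part of `C_d - C_{d+1}` which vanishes at `l = 0`
  have h3 : HasSum (fun l => p ^ (l * (l + d)) * (1 - p ^ l) * qfacInv p l *
      qfacInv p (l + (d + 1))) (cauchySeries p d - cauchySeries p (d + 1) +
        p ^ (d + 1) * cauchySeries p (d + 1)) := by
    refine ((h0.sub h1).add (h1.mul_left (p ^ (d + 1)))).congr_fun ?_
    intro l
    rw [← one_sub_mul_qfacInv_succ hp (l + d)]
    ring_nf
  rw [hasSum_nat_add_iff' 1 |>.symm] at h3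
  simp only [Finset.range_one, Finset.sum_singleton, pow_zero, sub_self, mul_zero, zero_mul,
    sub_zero] at h3
  have h4 : HasSum (fun l => p ^ ((l + 1) * (l + 1 + d)) * (1 - p ^ (l + 1)) * qfacInv p (l + 1) *
      qfacInv p (l + 1 + (d + 1))) (p ^ (d + 1) * cauchySeries p (d + 2)) := by
    refine (h2.mul_left (p ^ (d + 1))).congr_fun ?_
    intro l
    rw [← one_sub_mul_qfacInv_succ hp l]
    ring_nf
  linear_combination h3.unique h4

theorem cauchySeries_eq_zero (hp : X ∣ p) (d : ℕ) :
    cauchySeries p d = cauchySeries p 0 := by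
  have key : ∀ n d, (X : A⟦X⟧) ^ n ∣ cauchySeries p d - cauchySeries p (d + 1) := by
    intro n
    induction n with
    | zero => simp
    | succ n ih =>
      intro d
      rw [cauchySeries_sub_succ hp, pow_succ']
      exact mul_dvd_mul ((dvd_neg.2 (dvd_pow hp (Nat.succ_ne_zero d)))) (ih _)
  induction d with
  | zero => rfl
  | succ d ih =>
    rw [← ih]
    exact (eq_of_forall_X_pow_dvd_sub fun n => key n d).symm

theorem X_pow_dvd_cauchySeries_sub (hp : X ∣ p) (d : ℕ) :
    (X : A⟦X⟧) ^ d ∣ cauchySeries p d - qfacInv p d := by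
  have h := hasSum_cauchySeries hp d
  rw [hasSum_nat_add_iff' 1 |>.symm] at h
  simp only [Finset.range_one, Finset.sum_singleton, zero_mul, pow_zero, qfacInv_zero hp,
    mul_one, one_mul, zero_add] at h
  exact X_pow_dvd_of_hasSum h fun l => Dvd.dvd.mul_right (Dvd.dvd.mul_right
    (X_pow_dvd_pow hp (by nlinarith)) _) _

/-- The common value is the limit of the `l = 0` terms `1 / (p; p)_n`, while `eulerSeries p (-p)` is
the limit of `(p; p)_n`. -/
theorem cauchySeries_mul_eulerSeries (hp : X ∣ p) (d : ℕ) :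
    cauchySeries p d * eulerSeries p (-p) = 1 := by
  rw [cauchySeries_eq_zero hp]
  refine eq_of_forall_X_pow_dvd_sub fun n => ?_
  have h1 := X_pow_dvd_cauchySeries_sub hp n
  rw [cauchySeries_eq_zero hp] at h1
  have h2 : eulerSeries p (-p) = qfac p n * eulerSeries p (-p * p ^ n) := by
    rw [eulerSeries_eq_prod_mul hp (-p) n, qfac]
    congr 1
    exact Finset.prod_congr rfl fun i _ => by ring
  have h3 := X_pow_dvd_eulerSeries_sub_one (n := n) (z := -p * p ^ n) hp
    (Dvd.dvd.mul_left (X_pow_dvd_pow hp le_rfl) _)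
  have h4 : cauchySeries p 0 * eulerSeries p (-p) - 1 =
      (cauchySeries p 0 - qfacInv p n) * eulerSeries p (-p) +
        (eulerSeries p (-p * p ^ n) - 1) := by
    linear_combination qfacInv p n * h2 + eulerSeries p (-p * p ^ n) * qfac_mul_qfacInv hp n
  rw [h4]
  exact dvd_add (Dvd.dvd.mul_right h1 _) h3

/-- Pairs of natural numbers, by their difference and their minimum. -/
def intProdNatEquiv : ℤ × ℕ ≃ ℕ × ℕ where
  toFun x := (x.2 + x.1.toNat, x.2 + (-x.1).toNat)
  invFun y := ((y.1 : ℤ) - y.2, min y.1 y.2)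
  left_inv x := by ext <;> simp; lia
  right_inv y := by ext <;> simp <;> lia

/-- A product below `n` forces one factor below `n`; the bounded difference then bounds the other.
-/
theorem finite_mul_lt_and_sub_mem (n : ℕ) {s : Set ℤ} (hs : s.Finite) :
    {x : ℕ × ℕ | x.1 * x.2 < n ∧ (x.1 : ℤ) - x.2 ∈ s}.Finite := by
  obtain ⟨D, hD⟩ := (hs.image Int.natAbs).bddAbove
  refine ((Set.finite_Iic (n + D)).prod (Set.finite_Iic (n + D))).subset ?_
  rintro ⟨a, b⟩ ⟨h1, h2⟩
  have h3 : ((a : ℤ) - b).natAbs ≤ D := hD ⟨_, h2, rfl⟩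
  simp only [Set.mem_prod, Set.mem_Iic] at *
  have h4 : a < n ∨ b < n := by
    by_contra! h
    rcases Nat.eq_zero_or_pos n with rfl | hn
    · simp at h1
    · nlinarith [Nat.mul_le_mul h.1 h.2, Nat.mul_le_mul hn (le_refl n)]
  lia

/-- A bilateral series as a double series: `∑_{a,b} p ^ (ab) c_{a-b} / ((p; p)_a (p; p)_b)`
is the quotient of `∑_N c_N` by `(p; p)_∞`. -/
theorem hasSum_bilateral (hp : X ∣ p) {c : ℤ → A⟦X⟧}
    (hc : ∀ n, {N | ¬ (X : A⟦X⟧) ^ n ∣ c N}.Finite) :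
    HasSum (fun x : ℕ × ℕ => p ^ (x.1 * x.2) * qfacInv p x.1 * qfacInv p x.2 *
      c ((x.1 : ℤ) - x.2)) (cauchySeries p 0 * ∑' N, c N) := by
  have hs : Summable fun x : ℕ × ℕ => p ^ (x.1 * x.2) * qfacInv p x.1 * qfacInv p x.2 *
      c ((x.1 : ℤ) - x.2) := by
    refine summable_of_finite_not_X_pow_dvd fun n =>
      (finite_mul_lt_and_sub_mem n (hc n)).subset fun x hx => ⟨?_, fun h => ?_⟩
    · by_contra h
      exact hx (Dvd.dvd.mul_right (Dvd.dvd.mul_right (Dvd.dvd.mul_right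
        (X_pow_dvd_pow hp (not_lt.1 h)) _) _) _)
    · exact hx (Dvd.dvd.mul_left h _)
  -- Along a fixed difference `N`, the sum over the minimum is a Cauchy series with `d = |N|`, whose
  -- value does not depend on `d`.
  have h1 := (intProdNatEquiv.hasSum_iff.2 hs.hasSum).prod_fiberwise
    (g := fun N => cauchySeries p 0 * c N) fun N => ?_
  · have h2 := (summable_of_finite_not_X_pow_dvd hc).hasSum.mul_left (cauchySeries p 0)
    rw [← h1.unique h2]
    exact hs.hasSum
  · obtain ⟨d, rfl | rfl⟩ := N.eq_nat_or_neg
    · refine ((cauchySeries_eq_zero hp d ▸ hasSum_cauchySeries hp d).mul_right (c d)).congr_fun ?_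
      intro l
      simp [intProdNatEquiv]
      ring
    · refine ((cauchySeries_eq_zero hp d ▸ hasSum_cauchySeries hp d).mul_right
        (c (-d))).congr_fun ?_
      intro l
      simp [intProdNatEquiv]

end Cauchy

/-! ### Jacobi's triple product. -/

section TripleProduct

variable {A : Type*} [CommRing A] {p : A⟦X⟧} [TopologicalSpace A] [DiscreteTopology A]

/-- Jacobi's triple product identity, where `c N` is the coefficient
`p ^ (N choose 2) z ^ N` for `z z' = p`. -/
theorem eulerSeries_mul_eulerSeries (hp : X ∣ p) {z z' : A⟦X⟧} {c : ℤ → A⟦X⟧}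
    (hz : ∀ a b : ℕ, p ^ a.choose 2 * z ^ a * (p ^ b.choose 2 * z' ^ b) =
      p ^ (a * b) * c ((a : ℤ) - b))
    (hc : ∀ n, {N | ¬ (X : A⟦X⟧) ^ n ∣ c N}.Finite) :
    eulerSeries p z * eulerSeries p z' = cauchySeries p 0 * ∑' N, c N := by
  have h1 := hasSum_bilateral hp hc
  have h2 : (fun x : ℕ × ℕ => p ^ (x.1 * x.2) * qfacInv p x.1 * qfacInv p x.2 *
      c ((x.1 : ℤ) - x.2)) = fun x : ℕ × ℕ => p ^ x.1.choose 2 * z ^ x.1 * qfacInv p x.1 *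
        (p ^ x.2.choose 2 * z' ^ x.2 * qfacInv p x.2) := by
    funext x
    linear_combination (-qfacInv p x.1 * qfacInv p x.2) * hz x.1 x.2
  rw [h2] at h1
  exact ((hasSum_eulerSeries hp z).mul (hasSum_eulerSeries hp z') h1.summable).unique h1

end TripleProduct

/-! ### Gaussian binomial sums. -/

section GaussSum

variable {A : Type*} [CommRing A] {p : A⟦X⟧}

/-- The sum of `f a b` over `a + b = n`, weighted by Gaussian binomial coefficients. -/
noncomputable def gaussSum (p : A⟦X⟧) (n : ℕ) (f : ℕ → ℕ → A⟦X⟧) : A⟦X⟧ :=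
  qfac p n * ∑ x ∈ antidiagonal n, qfacInv p x.1 * qfacInv p x.2 * f x.1 x.2

theorem gaussSum_congr {n : ℕ} {f g : ℕ → ℕ → A⟦X⟧} (h : ∀ a b, a + b = n → f a b = g a b) :
    gaussSum p n f = gaussSum p n g := by
  unfold gaussSum
  congr 1
  exact Finset.sum_congr rfl fun x hx => by
    rw [h x.1 x.2 (Finset.HasAntidiagonal.mem_antidiagonal.1 hx)]

theorem gaussSum_zero (hp : X ∣ p) (f : ℕ → ℕ → A⟦X⟧) :
    gaussSum p 0 f = f 0 0 := by
  simp [gaussSum, qfacInv_zero hp, qfac]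

theorem gaussSum_add (n : ℕ) (f g : ℕ → ℕ → A⟦X⟧) :
    gaussSum p n (fun a b => f a b + g a b) = gaussSum p n f + gaussSum p n g := by
  simp only [gaussSum, mul_add, Finset.sum_add_distrib]

theorem gaussSum_const_mul (n : ℕ) (r : A⟦X⟧) (f : ℕ → ℕ → A⟦X⟧) :
    gaussSum p n (fun a b => r * f a b) = r * gaussSum p n f := by
  simp only [gaussSum, Finset.mul_sum]
  exact Finset.sum_congr rfl fun x _ => by ring

theorem gaussSum_swap (n : ℕ) (f : ℕ → ℕ → A⟦X⟧) :
    gaussSum p n (fun a b => f b a) = gaussSum p n f := by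
  unfold gaussSum
  rw [← Finset.Nat.sum_antidiagonal_swap]
  congr 1
  exact Finset.sum_congr rfl fun x _ => by simp only [Prod.fst_swap, Prod.snd_swap]; ring

theorem sum_antidiagonal_one_sub_pow_fst (hp : X ∣ p) (n : ℕ) (f : ℕ → ℕ → A⟦X⟧) :
    ∑ x ∈ antidiagonal (n + 1), qfacInv p x.1 * qfacInv p x.2 * ((1 - p ^ x.1) * f x.1 x.2) =
      ∑ x ∈ antidiagonal n, qfacInv p x.1 * qfacInv p x.2 * f (x.1 + 1) x.2 := by
  rw [Finset.Nat.sum_antidiagonal_succ]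
  simp only [pow_zero, sub_self, zero_mul, mul_zero, zero_add]
  refine Finset.sum_congr rfl fun x _ => ?_
  rw [← one_sub_mul_qfacInv_succ hp x.1]
  ring

theorem sum_antidiagonal_one_sub_pow_snd (hp : X ∣ p) (n : ℕ) (f : ℕ → ℕ → A⟦X⟧) :
    ∑ x ∈ antidiagonal (n + 1), qfacInv p x.1 * qfacInv p x.2 * ((1 - p ^ x.2) * f x.1 x.2) =
      ∑ x ∈ antidiagonal n, qfacInv p x.1 * qfacInv p x.2 * f x.1 (x.2 + 1) := by
  rw [Finset.Nat.sum_antidiagonal_succ']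
  simp only [pow_zero, sub_self, zero_mul, mul_zero, zero_add]
  refine Finset.sum_congr rfl fun x _ => ?_
  rw [← one_sub_mul_qfacInv_succ hp x.2]
  ring

/-- The q-Pascal rule, from `1 - p ^ (a + b) = (1 - p ^ a) + p ^ a * (1 - p ^ b)`. -/
theorem gaussSum_succ (hp : X ∣ p) (n : ℕ) (f : ℕ → ℕ → A⟦X⟧) :
    gaussSum p (n + 1) f = gaussSum p n fun a b => f (a + 1) b + p ^ a * f a (b + 1) := by
  have h : ∑ x ∈ antidiagonal (n + 1), (1 - p ^ (n + 1)) *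
      (qfacInv p x.1 * qfacInv p x.2 * f x.1 x.2) =
      ∑ x ∈ antidiagonal (n + 1), qfacInv p x.1 * qfacInv p x.2 * ((1 - p ^ x.1) * f x.1 x.2) +
      ∑ x ∈ antidiagonal (n + 1), qfacInv p x.1 * qfacInv p x.2 *
        ((1 - p ^ x.2) * (p ^ x.1 * f x.1 x.2)) := by
    rw [← Finset.sum_add_distrib]
    refine Finset.sum_congr rfl fun x hx => ?_
    rw [← Finset.HasAntidiagonal.mem_antidiagonal.1 hx]
    ring
  rw [gaussSum, qfac_succ, mul_assoc, Finset.mul_sum, h, sum_antidiagonal_one_sub_pow_fst hp n f,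
    sum_antidiagonal_one_sub_pow_snd hp n fun a b => p ^ a * f a b, ← Finset.sum_add_distrib,
    gaussSum]
  congr 1
  exact Finset.sum_congr rfl fun x _ => by ring

/-- The `q`-Vandermonde convolution. -/
theorem gaussSum_vandermonde (hp : X ∣ p) (b c : ℕ) (f : ℕ → ℕ → A⟦X⟧) :
    gaussSum p (b + c) f = gaussSum p b fun i i' => gaussSum p c fun l l' =>
      p ^ (i * l') * f (i + l) (i' + l') := by
  induction c generalizing f with
  | zero => simp [gaussSum_zero hp]
  | succ c ih =>
    rw [← add_assoc, gaussSum_succ hp, ih]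
    refine gaussSum_congr fun i i' _ => ?_
    rw [gaussSum_succ hp]
    refine gaussSum_congr fun l l' _ => ?_
    simp only [← add_assoc]
    ring

/-- Passing from weights `[n, a]` to weights `[n + 1, a]`. -/
theorem qfacInv_mul_gaussSum (hp : X ∣ p) (n : ℕ) (f : ℕ → A⟦X⟧) :
    qfacInv p n * gaussSum p n (fun a _ => f a) =
      qfacInv p (n + 1) * gaussSum p (n + 1) (fun a b => (1 - p ^ b) * f a) := by
  simp only [gaussSum]
  rw [sum_antidiagonal_one_sub_pow_snd hp n fun a _ => f a, ← mul_assoc, ← mul_assoc,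
    mul_comm (qfacInv p n), mul_comm (qfacInv p (n + 1)), qfac_mul_qfacInv hp,
    qfac_mul_qfacInv hp]

/-- For each index pair `y` of the second sum, the first is expanded by q-Vandermonde along `n = y.1
+ y.2`; the numerators `(p; p)_{y.1}` and `(p; p)_{y.2}` then cancel. -/
theorem qfacInv_mul_gaussSum_mul_gaussSum (hp : X ∣ p) (n : ℕ)
    (f g : ℕ → ℕ → A⟦X⟧) :
    qfacInv p n * gaussSum p n f * gaussSum p n g =
      ∑ y ∈ antidiagonal n, ∑ z ∈ antidiagonal y.1, ∑ w ∈ antidiagonal y.2,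
        qfacInv p z.1 * qfacInv p z.2 * (qfacInv p w.1 * qfacInv p w.2) *
          (p ^ (z.1 * w.2) * f (z.1 + w.1) (z.2 + w.2)) * g y.1 y.2 := by
  have h1 : qfacInv p n * gaussSum p n f * gaussSum p n g =
      ∑ y ∈ antidiagonal n, qfacInv p y.1 * qfacInv p y.2 * gaussSum p (y.1 + y.2) f *
        g y.1 y.2 := by
    have h2 : qfacInv p n * gaussSum p n g =
        ∑ y ∈ antidiagonal n, qfacInv p y.1 * qfacInv p y.2 * g y.1 y.2 := by
      rw [gaussSum, ← mul_assoc, mul_comm (qfacInv p n), qfac_mul_qfacInv hp, one_mul]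
    rw [mul_right_comm, h2, Finset.sum_mul]
    refine Finset.sum_congr rfl fun y hy => ?_
    rw [Finset.HasAntidiagonal.mem_antidiagonal.1 hy]
    ring
  rw [h1]
  refine Finset.sum_congr rfl fun y _ => ?_
  rw [gaussSum_vandermonde hp, gaussSum]
  simp only [gaussSum]
  have h3 : ∀ s, qfacInv p y.1 * qfacInv p y.2 * (qfac p y.1 * s) = qfacInv p y.2 * s := fun s => by
    linear_combination (qfacInv p y.2 * s) * qfac_mul_qfacInv hp y.1
  rw [h3, Finset.mul_sum, Finset.sum_mul]
  refine Finset.sum_congr rfl fun z _ => ?_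
  have h4 : ∀ s t, qfacInv p y.2 * (t * (qfac p y.2 * s)) = t * s := fun s t => by
    linear_combination (t * s) * qfac_mul_qfacInv hp y.2
  rw [h4, Finset.mul_sum, Finset.sum_mul]
  exact Finset.sum_congr rfl fun w _ => by ring

end GaussSum

/-! ### Generating functions of strict partitions, by largest part and by length. -/

section StrictLists

variable {A : Type*} [CommRing A] (Y : Aˣ)

/-- The power `y ^ n`. -/
noncomputable def yPow (n : ℤ) : A⟦X⟧ := PowerSeries.C ((Y ^ n : Aˣ) : A)

theorem yPow_add (m n : ℤ) : yPow Y (m + n) = yPow Y m * yPow Y n := by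
  rw [yPow, zpow_add, Units.val_mul, map_mul]; rfl

theorem yPow_zero : yPow Y 0 = 1 := by simp [yPow]

theorem X_dvd_X_sq : (X : A⟦X⟧) ∣ X ^ 2 := dvd_pow_self _ two_ne_zero

/-- A strict partition: a strictly decreasing list of positive integers. -/
def IsStrict (w : List ℕ) : Prop := w.Pairwise (· > ·) ∧ ∀ c ∈ w, 0 < c

/-- The alternating sum of the parities of the entries. -/
def altParity : List ℕ → ℤ
  | [] => 0
  | c :: w => ((c % 2 : ℕ) : ℤ) - altParity w

/-- The weight of a strict partition; the sign `ε` records the residue of the first node. -/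
noncomputable def weight (ε : ℤ) (w : List ℕ) : A⟦X⟧ :=
  X ^ w.sum * yPow Y (ε * altParity w)

theorem isStrict_nil : IsStrict [] := by simp [IsStrict]

theorem isStrict_cons {c : ℕ} {w : List ℕ} :
    IsStrict (c :: w) ↔ IsStrict w ∧ 0 < c ∧ ∀ d ∈ w, d < c := by
  simp only [IsStrict, List.pairwise_cons, List.mem_cons, forall_eq_or_imp]
  tauto

theorem isStrict_map_succ {w : List ℕ} :
    IsStrict (w.map Nat.succ) ↔ w.Pairwise (· > ·) := by
  simp [IsStrict, List.pairwise_map]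

theorem isStrict_map_succ_append {w : List ℕ} :
    IsStrict (w.map Nat.succ ++ [1]) ↔ IsStrict w := by
  induction w with
  | nil => simp [IsStrict]
  | cons c w ih =>
    rw [List.map_cons, List.cons_append, isStrict_cons, isStrict_cons, ih]
    simp only [List.mem_append, List.mem_map, List.mem_singleton]
    constructor
    · rintro ⟨h1, -, h2⟩
      exact ⟨h1, Nat.succ_lt_succ_iff.1 (h2 1 (Or.inr rfl)),
        fun d hd => Nat.succ_lt_succ_iff.1 (h2 _ (Or.inl ⟨d, hd, rfl⟩))⟩
    · rintro ⟨h1, h2, h3⟩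
      refine ⟨h1, Nat.succ_pos c, ?_⟩
      rintro d (⟨d, hd, rfl⟩ | rfl)
      · exact Nat.succ_lt_succ (h3 d hd)
      · exact Nat.succ_lt_succ h2

/-- Every parity `e` becomes `1 - e`, and the alternating sum of ones is the parity of the length.
-/
theorem altParity_map_succ (w : List ℕ) :
    altParity (w.map Nat.succ) = ((w.length % 2 : ℕ) : ℤ) - altParity w := by
  induction w with
  | nil => simp [altParity]
  | cons c w ih =>
    simp only [List.map_cons, altParity, ih, List.length_cons]
    lia

theorem altParity_map_succ_append (w : List ℕ) :
    altParity (w.map Nat.succ ++ [1]) = (((w.length + 1) % 2 : ℕ) : ℤ) - altParity w := by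
  induction w with
  | nil => simp [altParity]
  | cons c w ih =>
    simp only [List.map_cons, altParity, ih, List.length_cons, List.cons_append]
    lia

theorem sum_map_succ (w : List ℕ) : (w.map Nat.succ).sum = w.sum + w.length := by
  induction w with
  | nil => rfl
  | cons c w ih =>
    simp only [List.map_cons, List.sum_cons, ih, List.length_cons]
    lia

/-- The strict partitions with parts at most `m`. -/
def strictLists : ℕ → Finset (List ℕ)
  | 0 => {[]}
  | m + 1 => strictLists m ∪ (strictLists m).image (List.cons (m + 1))

theorem mem_strictLists {m : ℕ} {w : List ℕ} :
    w ∈ strictLists m ↔ IsStrict w ∧ ∀ c ∈ w, c ≤ m := by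
  induction m generalizing w with
  | zero =>
    simp only [strictLists, Finset.mem_singleton]
    constructor
    · rintro rfl
      simp [isStrict_nil]
    · rintro ⟨h1, h2⟩
      rcases w with _ | ⟨c, w⟩
      · rfl
      · have := h1.2 c List.mem_cons_self
        have := h2 c List.mem_cons_self
        lia
  | succ m ih =>
    simp only [strictLists, Finset.mem_union, Finset.mem_image, ih]
    constructor
    · rintro (⟨h1, h2⟩ | ⟨w, ⟨h1, h2⟩, rfl⟩)
      · exact ⟨h1, fun c hc => (h2 c hc).trans (Nat.le_succ m)⟩
      · refine ⟨isStrict_cons.2 ⟨h1, Nat.succ_pos m, fun d hd => Nat.lt_succ_of_le (h2 d hd)⟩, ?_⟩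
        simp only [List.mem_cons, forall_eq_or_imp, le_refl, true_and]
        exact fun c hc => (h2 c hc).trans (Nat.le_succ m)
    · rintro ⟨h1, h2⟩
      rcases w with _ | ⟨c, w⟩
      · exact Or.inl ⟨h1, by simp⟩
      · have h3 := isStrict_cons.1 h1
        rcases Nat.lt_or_ge m c with h | h
        · have h4 : c = m + 1 := le_antisymm (h2 c List.mem_cons_self) h
          subst h4
          exact Or.inr ⟨w, ⟨h3.1, fun d hd => Nat.le_of_lt_succ (h3.2.2 d hd)⟩, rfl⟩
        · refine Or.inl ⟨h1, ?_⟩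
          simp only [List.mem_cons, forall_eq_or_imp]
          exact ⟨h, fun d hd => (h3.2.2 d hd).le.trans h⟩

/-- The generating function of the strict partitions with parts at most `m`. -/
noncomputable def boundedGen (m : ℕ) (ε : ℤ) : A⟦X⟧ := ∑ w ∈ strictLists m, weight Y ε w

/-- Split on whether `m + 1` is a part. It would come first, and prepending it reverses the signs of
the remaining parities. -/
theorem boundedGen_succ (m : ℕ) (ε : ℤ) :
    boundedGen Y (m + 1) ε = boundedGen Y m ε +
      X ^ (m + 1) * yPow Y (ε * ((m + 1) % 2 : ℕ)) * boundedGen Y m (-ε) := by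
  rw [boundedGen, strictLists, Finset.sum_union, Finset.sum_image, boundedGen, boundedGen,
    Finset.mul_sum]
  · congr 1
    refine Finset.sum_congr rfl fun w _ => ?_
    rw [weight, weight, List.sum_cons, altParity, pow_add, mul_sub, sub_eq_add_neg, yPow_add,
      neg_mul]
    ring
  · exact fun a _ b _ h => (List.cons.inj h).2
  · rw [Finset.disjoint_left]
    rintro w hw hw'
    obtain ⟨w, -, rfl⟩ := Finset.mem_image.1 hw'
    have := (mem_strictLists.1 hw).2 (m + 1) List.mem_cons_self
    lia

/-- The exponent of `y` attached to the Gaussian binomial coefficient `[m, b]`. -/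
def yExp (m b : ℕ) : ℤ := if Even m then b - (m / 2 : ℕ) else ((m + 1) / 2 : ℕ) - b

theorem yExp_succ (m b : ℕ) : yExp (m + 1) b = ((m + 1) % 2 : ℕ) - yExp m b := by
  unfold yExp
  rcases Nat.even_or_odd m with h | h
  · rw [if_pos h, if_neg (by simpa [Nat.even_add_one] using h)]
    obtain ⟨r, rfl⟩ := h
    lia
  · rw [if_neg (Nat.not_even_iff_odd.2 h), if_pos (by simpa [Nat.even_add_one] using h)]
    obtain ⟨r, rfl⟩ := h
    lia

theorem yExp_succ_succ {m a b : ℕ} (h : a + b = m) : yExp (m + 1) (b + 1) = yExp m a := by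
  rw [yExp_succ]
  subst h
  unfold yExp
  split_ifs with h
  · obtain ⟨r, hr⟩ := h
    lia
  · obtain ⟨r, hr⟩ := Nat.not_even_iff_odd.1 h
    lia

/-- The two halves of the q-Pascal rule match the split on the part `m + 1`. When the part is
absent, the two indices are exchanged, as in `yExp_succ_succ`; the prefactor keeps all exponents of
`X` natural. -/
theorem X_pow_mul_boundedGen (m : ℕ) (ε : ℤ) :
    X ^ (m + 1).choose 2 * boundedGen Y m ε =
      gaussSum (X ^ 2) m fun b c => X ^ (b ^ 2 + c ^ 2 + c) * yPow Y (ε * yExp m b) := by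
  induction m generalizing ε with
  | zero => simp [boundedGen, strictLists, weight, gaussSum_zero X_dvd_X_sq, altParity, yExp]
  | succ m ih =>
    rw [gaussSum_succ X_dvd_X_sq, gaussSum_add, ← gaussSum_swap, boundedGen_succ, mul_add,
      choose_two_succ]
    congr 1
    · rw [pow_add, mul_right_comm, ih, mul_comm, ← gaussSum_const_mul]
      refine gaussSum_congr fun a b h => ?_
      rw [yExp_succ_succ h, ← mul_assoc, ← pow_add, ← h]
      ring_nf
    · rw [pow_add, show ∀ s t u v w : A⟦X⟧, s * t * (u * v * w) = t * u * v * (s * w) from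
        fun _ _ _ _ _ => by ring, ih, ← gaussSum_const_mul]
      refine gaussSum_congr fun a b h => ?_
      rw [yExp_succ, mul_sub, sub_eq_add_neg, yPow_add, ← neg_mul, ← h]
      ring

open Classical in
/-- The weight of a strict partition with `k` parts. -/
noncomputable def lengthTerm (k : ℕ) (ε : ℤ) (w : List ℕ) : A⟦X⟧ :=
  if IsStrict w ∧ w.length = k then weight Y ε w else 0

theorem finite_isStrict_sum_lt (n : ℕ) : {w | IsStrict w ∧ w.sum < n}.Finite := by
  refine (strictLists n).finite_toSet.subset fun w hw => ?_
  exact Finset.mem_coe.2 (mem_strictLists.2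
    ⟨hw.1, fun c hc => (List.single_le_sum (by simp) c hc).trans hw.2.le⟩)

theorem isStrict_exists_map_succ {w : List ℕ} (h : IsStrict w) (h1 : 1 ∉ w) :
    ∃ w', IsStrict w' ∧ w'.map Nat.succ = w := by
  induction w with
  | nil => exact ⟨[], isStrict_nil, rfl⟩
  | cons c w ih =>
    rw [isStrict_cons] at h
    obtain ⟨w', h2, rfl⟩ := ih h.1 fun h2 => h1 (List.mem_cons_of_mem _ h2)
    have h3 : c ≠ 1 := fun h2 => h1 (h2 ▸ List.mem_cons_self)
    refine ⟨(c - 1) :: w', isStrict_cons.2 ⟨h2, by lia, fun d hd => ?_⟩, ?_⟩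
    · have := h.2.2 (d + 1) (List.mem_map_of_mem hd)
      lia
    · simp only [List.map_cons, List.cons.injEq, and_true]
      lia

theorem isStrict_exists_map_succ_append {w : List ℕ} (h : IsStrict w) (h1 : 1 ∈ w) :
    ∃ w', IsStrict w' ∧ w'.map Nat.succ ++ [1] = w := by
  induction w with
  | nil => simp at h1
  | cons c w ih =>
    rw [isStrict_cons] at h
    rcases List.mem_cons.1 h1 with rfl | h2
    · rcases w with _ | ⟨d, w⟩
      · exact ⟨[], isStrict_nil, rfl⟩
      · have h3 := h.2.2 d List.mem_cons_self
        have h4 := h.1.2 d List.mem_cons_self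
        lia
    · obtain ⟨w', h3, rfl⟩ := ih h.1 h2
      have h4 := h.2.2 1 h2
      refine ⟨(c - 1) :: w', isStrict_cons.2 ⟨h3, by lia, fun d hd => ?_⟩, ?_⟩
      · have := h.2.2 (d + 1) (List.mem_append_left _ (List.mem_map_of_mem hd))
        lia
      · simp only [List.map_cons, List.cons_append, List.cons.injEq, and_true]
        lia

theorem weight_map_succ (ε : ℤ) (w : List ℕ) : weight Y ε (w.map Nat.succ) =
    X ^ w.length * yPow Y (ε * (w.length % 2 : ℕ)) * weight Y (-ε) w := by
  rw [weight, weight, altParity_map_succ, sum_map_succ, mul_sub, sub_eq_add_neg, yPow_add, neg_mul,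
    pow_add]
  ring

theorem weight_map_succ_append (ε : ℤ) (w : List ℕ) : weight Y ε (w.map Nat.succ ++ [1]) =
    X ^ (w.length + 1) * yPow Y (ε * ((w.length + 1) % 2 : ℕ)) * weight Y (-ε) w := by
  rw [weight, weight, altParity_map_succ_append, List.sum_append, sum_map_succ, mul_sub,
    sub_eq_add_neg, yPow_add, neg_mul, List.sum_singleton]
  ring

variable [TopologicalSpace A]

theorem summable_lengthTerm (k : ℕ) (ε : ℤ) : Summable (lengthTerm Y k ε) := by
  refine summable_of_finite_not_X_pow_dvd fun n =>
    (finite_isStrict_sum_lt n).subset fun w hw => ?_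
  by_contra h
  refine hw ?_
  unfold lengthTerm
  split_ifs with h1
  · exact Dvd.dvd.mul_right (pow_dvd_pow _ (not_lt.1 fun h2 => h ⟨h1.1, h2⟩)) _
  · exact dvd_zero _

/-- The generating function of the strict partitions with `k` parts. -/
noncomputable def lengthGen (k : ℕ) (ε : ℤ) : A⟦X⟧ := ∑' w, lengthTerm Y k ε w

theorem hasSum_lengthTerm (k : ℕ) (ε : ℤ) : HasSum (lengthTerm Y k ε) (lengthGen Y k ε) :=
  (summable_lengthTerm Y k ε).hasSum

theorem lengthGen_zero (ε : ℤ) : lengthGen Y 0 ε = 1 := by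
  rw [lengthGen, tsum_eq_single []]
  · simp [lengthTerm, isStrict_nil, weight, altParity, yPow_zero]
  · intro w hw
    rw [lengthTerm, if_neg fun h => hw (List.length_eq_zero_iff.1 h.2)]

variable [DiscreteTopology A]

/-- Subtract one from every part, discarding a final part `1` if there is one. All parities flip, so
`ε` changes sign. -/
theorem lengthGen_succ (k : ℕ) (ε : ℤ) : lengthGen Y (k + 1) ε =
    X ^ (k + 1) * yPow Y (ε * ((k + 1) % 2 : ℕ)) *
      (lengthGen Y (k + 1) (-ε) + lengthGen Y k (-ε)) := by
  classical
  set c := X ^ (k + 1) * yPow Y (ε * ((k + 1) % 2 : ℕ)) with hc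
  have h1 : HasSum (fun w => if 1 ∈ w then 0 else lengthTerm Y (k + 1) ε w)
      (c * lengthGen Y (k + 1) (-ε)) := by
    rw [← (List.map_injective_iff.2 Nat.succ_injective).hasSum_iff]
    · refine ((hasSum_lengthTerm Y (k + 1) (-ε)).mul_left c).congr_fun fun w => ?_
      simp only [Function.comp_apply, lengthTerm, List.length_map]
      by_cases h : IsStrict w ∧ w.length = k + 1
      · rw [if_pos h, if_neg, if_pos ⟨isStrict_map_succ.2 h.1.1, h.2⟩, weight_map_succ, h.2]
        simpa using fun h0 => (h.1.2 0 h0).ne rfl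
      · rw [if_neg h, mul_zero]
        split_ifs with h2 h3
        · rfl
        · refine absurd ⟨⟨isStrict_map_succ.1 h3.1, fun c hc => ?_⟩, h3.2⟩ h
          rcases c with _ | c
          · exact absurd (List.mem_map_of_mem hc) h2
          · exact Nat.succ_pos c
        · rfl
    · intro w hw
      split_ifs with h2
      · rfl
      · refine if_neg fun h3 => ?_
        obtain ⟨w', -, h4⟩ := isStrict_exists_map_succ h3.1 h2
        exact hw ⟨w', h4⟩
  have h2 : HasSum (fun w => if 1 ∈ w then lengthTerm Y (k + 1) ε w else 0)
      (c * lengthGen Y k (-ε)) := by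
    have hinj : Function.Injective fun w : List ℕ => w.map Nat.succ ++ [1] := fun a b h =>
      List.map_injective_iff.2 Nat.succ_injective (List.append_cancel_right h)
    rw [← hinj.hasSum_iff]
    · refine ((hasSum_lengthTerm Y k (-ε)).mul_left c).congr_fun fun w => ?_
      simp only [Function.comp_apply, lengthTerm, List.length_append, List.length_map,
        List.length_singleton, isStrict_map_succ_append, List.mem_append, List.mem_singleton,
        or_true, if_true, Nat.add_right_cancel_iff]
      by_cases h : IsStrict w ∧ w.length = k
      · rw [if_pos h, if_pos h, weight_map_succ_append, h.2]
      · rw [if_neg h, if_neg h, mul_zero]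
    · intro w hw
      split_ifs with h2
      · refine if_neg fun h3 => ?_
        obtain ⟨w', -, h4⟩ := isStrict_exists_map_succ_append h3.1 h2
        exact hw ⟨w', h4⟩
      · rfl
  rw [mul_add]
  refine (hasSum_lengthTerm Y (k + 1) ε).unique ((h1.add h2).congr_fun fun w => ?_)
  split_ifs <;> simp

theorem lengthGen_eq (k : ℕ) (ε : ℤ) : lengthGen Y k ε =
    X ^ (k + 1).choose 2 * (qfacInv (X ^ 2) k *
      gaussSum (X ^ 2) k fun a _ => X ^ a * yPow Y (ε * yExp k a)) := by
  induction k generalizing ε with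
  | zero => simp [lengthGen_zero, qfacInv_zero X_dvd_X_sq, gaussSum_zero X_dvd_X_sq, yExp,
      yPow_zero]
  | succ k ih =>
    have h1 : yPow Y (ε * ((k + 1) % 2 : ℕ)) * yPow Y (-ε * ((k + 1) % 2 : ℕ)) = 1 := by
      rw [← yPow_add, neg_mul, add_neg_cancel, yPow_zero]
    -- Applying the recurrence twice returns to the sign `ε` with the factor `X ^ (2 * (k + 1))`;
    -- hence the base `X ^ 2`.
    have h2 : (1 - (X ^ 2) ^ (k + 1)) * lengthGen Y (k + 1) ε =
        X ^ (k + 1) * (yPow Y (ε * ((k + 1) % 2 : ℕ)) * lengthGen Y k (-ε) +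
          X ^ (k + 1) * lengthGen Y k ε) := by
      have h3 := lengthGen_succ Y k ε
      have h4 := lengthGen_succ Y k (-ε)
      rw [neg_neg] at h4
      linear_combination h3 + X ^ (k + 1) * yPow Y (ε * ((k + 1) % 2 : ℕ)) * h4 +
        (X ^ (k + 1)) ^ 2 * (lengthGen Y (k + 1) ε + lengthGen Y k ε) * h1
    have h5 : gaussSum (X ^ 2) (k + 1) (fun a _ => X ^ a * yPow Y (ε * yExp (k + 1) a)) =
        yPow Y (ε * ((k + 1) % 2 : ℕ)) *
            gaussSum (X ^ 2) k (fun a _ => X ^ a * yPow Y (-ε * yExp k a)) +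
          X ^ (k + 1) * gaussSum (X ^ 2) k (fun a _ => X ^ a * yPow Y (ε * yExp k a)) := by
      rw [← gaussSum_swap, gaussSum_succ X_dvd_X_sq, gaussSum_add, ← gaussSum_swap]
      rw [← gaussSum_const_mul, ← gaussSum_const_mul]
      congr 1
      · refine gaussSum_congr fun a b h => ?_
        rw [yExp_succ, mul_sub, sub_eq_add_neg, yPow_add, ← neg_mul]
        ring
      · refine gaussSum_congr fun a b h => ?_
        rw [yExp_succ_succ h, ← h]
        ring
    rw [ih, ih] at h2
    rw [h5, choose_two_succ]
    have h6 := one_sub_mul_qfacInv_succ (X_dvd_X_sq (A := A)) k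
    have h7 : qfac (X ^ 2 : A⟦X⟧) k * qfacInv (X ^ 2) (k + 1) * (1 - (X ^ 2) ^ (k + 1)) = 1 := by
      rw [mul_right_comm, ← qfac_succ, qfac_mul_qfacInv X_dvd_X_sq]
    have h8 := qfac_mul_qfacInv (X_dvd_X_sq (A := A)) k
    linear_combination (-lengthGen Y (k + 1) ε) * h7 + qfac (X ^ 2) k * qfacInv (X ^ 2) (k + 1) * h2 +
      qfacInv (X ^ 2) (k + 1) * X ^ (k + 1) * X ^ (k + 1).choose 2 * (yPow Y (ε * ((k + 1) % 2 : ℕ)) *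
        gaussSum (X ^ 2) k (fun a _ => X ^ a * yPow Y (-ε * yExp k a)) +
        X ^ (k + 1) * gaussSum (X ^ 2) k (fun a _ => X ^ a * yPow Y (ε * yExp k a))) * h8

end StrictLists

/-! ### From Young diagrams to strict partitions, and `ω` in terms of columns. -/

section Columns

/-- The list of column lengths of a Young diagram. -/
def columns (μ : YoungDiagram) : List ℕ := μ.transpose.rowLens

theorem columns_eq (μ : YoungDiagram) : columns μ = (List.range (μ.rowLen 0)).map μ.colLen := by
  rw [columns, YoungDiagram.rowLens, YoungDiagram.colLen_transpose]
  exact List.map_congr_left fun i _ => YoungDiagram.rowLen_transpose μ i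

theorem length_columns (μ : YoungDiagram) : (columns μ).length = μ.rowLen 0 := by
  simp [columns_eq]

theorem columns_injective : Function.Injective columns := fun μ ν h => by
  rw [← YoungDiagram.transpose_eq_iff]
  exact YoungDiagram.equivListRowLens.injective (Subtype.ext h)

theorem columns_pos (μ : YoungDiagram) : ∀ c ∈ columns μ, 0 < c :=
  YoungDiagram.pos_of_mem_rowLens _

theorem exists_columns_eq {w : List ℕ} (h : IsStrict w) : ∃ μ, columns μ = w := by
  refine ⟨(YoungDiagram.ofRowLens w (List.Pairwise.sortedGE (h.1.imp le_of_lt))).transpose, ?_⟩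
  rw [columns, YoungDiagram.transpose_transpose, YoungDiagram.rowLens_ofRowLens_eq_self h.2]

theorem forall_mem_columns_le_iff (μ : YoungDiagram) (m : ℕ) :
    (∀ c ∈ columns μ, c ≤ m) ↔ μ.colLen 0 ≤ m := by
  simp only [columns_eq, List.mem_map, List.mem_range, forall_exists_index, and_imp,
    forall_apply_eq_imp_iff₂]
  constructor
  · intro h
    rcases Nat.eq_zero_or_pos (μ.rowLen 0) with h0 | h0
    · rcases Nat.eq_zero_or_pos (μ.colLen 0) with h1 | h1
      · lia
      · rw [gt_iff_lt, ← YoungDiagram.mem_iff_lt_colLen, YoungDiagram.mem_iff_lt_rowLen] at h1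
        lia
    · exact h 0 h0
  · exact fun h j _ => (μ.colLen_anti 0 j (Nat.zero_le j)).trans h

/-- Two adjacent columns of equal length end in the same row, and that row exceeds the next by at
least two; conversely such a row yields two equal columns. -/
theorem isRestricted_two_iff (μ : YoungDiagram) : IsRestricted 2 μ ↔ IsStrict (columns μ) := by
  have h1 : IsStrict (columns μ) ↔ ∀ j, j + 1 < μ.rowLen 0 → μ.colLen (j + 1) < μ.colLen j := by
    rw [IsStrict, and_iff_left (columns_pos μ), List.pairwise_iff_getElem]
    simp only [columns_eq, List.length_map, List.length_range, List.getElem_map,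
      List.getElem_range, gt_iff_lt]
    constructor
    · exact fun h j hj => h j (j + 1) (by lia) hj (by lia)
    · intro h i j hi hj hij
      exact (μ.colLen_anti (i + 1) j hij).trans_lt (h i (by lia))
  rw [h1]
  constructor
  · intro h j hj
    by_contra! hc
    have h2 : 0 < μ.colLen (j + 1) := by
      rwa [← YoungDiagram.mem_iff_lt_colLen, YoungDiagram.mem_iff_lt_rowLen]
    obtain ⟨i, hi⟩ := Nat.exists_eq_succ_of_ne_zero h2.ne'
    have h3 : (i, j + 1) ∈ μ := by rw [YoungDiagram.mem_iff_lt_colLen]; lia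
    have h4 : (i + 1, j) ∉ μ := by
      rw [YoungDiagram.mem_iff_lt_colLen]
      have := μ.colLen_anti j (j + 1) (Nat.le_succ j)
      lia
    have h5 := h i ((by lia : i < μ.colLen (j + 1)).trans_le
      (μ.colLen_anti 0 (j + 1) (Nat.zero_le _)))
    rw [YoungDiagram.mem_iff_lt_rowLen] at h3 h4
    lia
  · intro h i _
    by_contra! hc
    have h3 : (i, μ.rowLen (i + 1) + 1) ∈ μ := by rw [YoungDiagram.mem_iff_lt_rowLen]; lia
    have h4 : (i + 1, μ.rowLen (i + 1)) ∉ μ := by rw [YoungDiagram.mem_iff_lt_rowLen]; lia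
    have h5 := h (μ.rowLen (i + 1)) ((by lia : μ.rowLen (i + 1) + 1 < μ.rowLen i).trans_le
      (μ.rowLen_anti 0 i (Nat.zero_le i)))
    rw [YoungDiagram.mem_iff_lt_colLen] at h3 h4
    lia

/-- The sign of a residue. -/
def residueSign (r : ZMod 2) : ℤ := if r = 0 then 1 else -1

theorem residueSign_add_one (r : ZMod 2) : residueSign (r + 1) = -residueSign r := by
  revert r; decide

theorem sum_cells_eq_sum_cellsOfRowLens (μ : YoungDiagram) (f : ℕ × ℕ → ℤ) :
    ∑ c ∈ μ.cells, f c = ∑ c ∈ YoungDiagram.cellsOfRowLens (columns μ), f c.swap := by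
  have h : μ.transpose.cells = YoungDiagram.cellsOfRowLens (columns μ) := by
    conv_lhs => rw [← YoungDiagram.ofRowLens_to_rowLens_eq_self (μ := μ.transpose)]
    rfl
  rw [← h]
  refine Finset.sum_bij' (fun c _ => c.swap) (fun c _ => c.swap) ?_ ?_ ?_ ?_ ?_ <;>
    simp [YoungDiagram.mem_transpose]

theorem sum_cellsOfRowLens_cons (c : ℕ) (w : List ℕ) (f : ℕ × ℕ → ℤ) :
    ∑ x ∈ YoungDiagram.cellsOfRowLens (c :: w), f x =
      ∑ i ∈ Finset.range c, f (0, i) +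
        ∑ x ∈ YoungDiagram.cellsOfRowLens w, f (x.1 + 1, x.2) := by
  rw [YoungDiagram.cellsOfRowLens, Finset.sum_union, Finset.sum_map, Finset.sum_product]
  · simp only [Finset.sum_singleton]
    rfl
  · rw [Finset.disjoint_left]
    rintro ⟨a, b⟩ h1 h2
    simp only [Finset.mem_product, Finset.mem_singleton] at h1
    obtain ⟨y, -, hy⟩ := Finset.mem_map.1 h2
    have := congrArg Prod.fst hy
    simp [h1.1] at this

theorem card_eq_sum_columns (μ : YoungDiagram) : μ.card = (columns μ).sum := by
  have h : ∀ w : List ℕ, ∑ _c ∈ YoungDiagram.cellsOfRowLens w, (1 : ℤ) = w.sum := by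
    intro w
    induction w with
    | nil => simp [YoungDiagram.cellsOfRowLens]
    | cons c w ih => rw [sum_cellsOfRowLens_cons, ih]; simp
  have h1 := sum_cells_eq_sum_cellsOfRowLens μ fun _ => 1
  rw [h, Finset.sum_const, nsmul_one] at h1
  exact_mod_cast h1

theorem sum_range_residueSign (c : ℕ) (t : ZMod 2) :
    ∑ i ∈ Finset.range c, residueSign (-(i : ZMod 2) + t) =
      residueSign t * ((c % 2 : ℕ) : ℤ) := by
  have h : ∀ i : ℕ, residueSign (-(i : ZMod 2) + t) = residueSign t * (1 - 2 * (i % 2 : ℕ)) := by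
    intro i
    induction i with
    | zero => simp
    | succ i ih =>
      have h1 : -((i + 1 : ℕ) : ZMod 2) + t = (-(i : ZMod 2) + t) + 1 := by
        push_cast
        rw [neg_add, CharTwo.neg_eq (1 : ZMod 2)]
        ring
      rw [h1, residueSign_add_one, ih]
      rcases Nat.mod_two_eq_zero_or_one i with h2 | h2
      · rw [h2, show (i + 1) % 2 = 1 by lia]; push_cast; ring
      · rw [h2, show (i + 1) % 2 = 0 by lia]; push_cast; ring
  induction c with
  | zero => simp
  | succ c ih =>
    rw [Finset.sum_range_succ, ih, h, ← mul_add]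
    congr 1
    lia

/-- Signs alternate down a column, leaving its parity times the sign of its top node; moving one
column right flips that sign. -/
theorem sum_cells_residueSign (μ : YoungDiagram) (t : ZMod 2) :
    ∑ c ∈ μ.cells, residueSign ((c.2 : ZMod 2) - c.1 + t) =
      residueSign t * altParity (columns μ) := by
  rw [sum_cells_eq_sum_cellsOfRowLens]
  generalize columns μ = w
  induction w generalizing t with
  | nil => simp [YoungDiagram.cellsOfRowLens, altParity]
  | cons c w ih =>
    rw [sum_cellsOfRowLens_cons]
    have h1 : ∀ x : ℕ × ℕ, residueSign ((((x.1 + 1, x.2) : ℕ × ℕ).swap.2 : ZMod 2) -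
        ((x.1 + 1, x.2) : ℕ × ℕ).swap.1 + t) =
        residueSign ((x.swap.2 : ZMod 2) - x.swap.1 + (t + 1)) := by
      intro x
      congr 1
      simp only [Prod.swap]
      push_cast
      ring
    simp only [h1, ih, residueSign_add_one]
    have h2 := sum_range_residueSign c t
    simp only [Prod.swap, Nat.cast_zero, zero_sub, altParity, h2]
    ring

theorem omega_eq (a : ℕ) {m : ℕ} (μ : Multipartition m) :
    omega a μ = ∑ s, residueSign (charge a m s : ZMod 2) * altParity (columns (μ s)) := by
  have h1 : omega a μ = ∑ c ∈ μ.nodes, residueSign (residue 2 (charge a m) c) := by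
    rw [omega, residueCount, residueCount, Finset.card_filter, Finset.card_filter]
    push_cast
    rw [← Finset.sum_sub_distrib]
    refine Finset.sum_congr rfl fun c _ => ?_
    generalize residue 2 (charge a m) c = r
    revert r; decide
  rw [h1, Multipartition.nodes, Finset.sum_sigma]
  exact Finset.sum_congr rfl fun s _ => sum_cells_residueSign (μ s) (charge a m s : ZMod 2)

end Columns

/-! ### Pairs of strict partitions, summed by the length of the second. -/

section Pairs

variable {A : Type*} [CommRing A] (Y : Aˣ)

open Classical in
/-- The weight of a pair of strict partitions with the parts of the first one bounded by the
number of parts of the second one plus `s`. -/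
noncomputable def pairTerm (s : ℕ) (ε : ℤ) (vw : List ℕ × List ℕ) : A⟦X⟧ :=
  if IsStrict vw.1 ∧ IsStrict vw.2 ∧ ∀ c ∈ vw.1, c ≤ vw.2.length + s then
    weight Y 1 vw.1 * weight Y ε vw.2 else 0

variable [TopologicalSpace A]

theorem summable_pairTerm (s : ℕ) (ε : ℤ) : Summable (pairTerm Y s ε) := by
  refine summable_of_finite_not_X_pow_dvd fun n =>
    ((finite_isStrict_sum_lt n).prod (finite_isStrict_sum_lt n)).subset fun vw hvw => ?_
  unfold pairTerm at hvw
  by_cases h : IsStrict vw.1 ∧ IsStrict vw.2 ∧ ∀ c ∈ vw.1, c ≤ vw.2.length + s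
  · refine ⟨⟨h.1, ?_⟩, h.2.1, ?_⟩ <;> by_contra h1 <;> refine hvw ?_ <;> rw [if_pos h]
    · exact Dvd.dvd.mul_right (Dvd.dvd.mul_right (pow_dvd_pow _ (not_lt.1 h1)) _) _
    · exact Dvd.dvd.mul_left (Dvd.dvd.mul_right (pow_dvd_pow _ (not_lt.1 h1)) _) _
  · exact absurd (by rw [if_neg h]; exact dvd_zero _) hvw

variable [DiscreteTopology A]

/-- For a fixed second partition `w`, the first ranges over `strictLists (w.length + s)`; the
resulting sum over `w` is then grouped by length. -/
theorem hasSum_boundedGen_mul_lengthGen (s : ℕ) (ε : ℤ) :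
    HasSum (fun k => boundedGen Y (k + s) 1 * lengthGen Y k ε) (∑' vw, pairTerm Y s ε vw) := by
  classical
  have h1 : HasSum (fun w => if IsStrict w then boundedGen Y (w.length + s) 1 * weight Y ε w else 0)
      (∑' vw, pairTerm Y s ε vw) := by
    refine ((Equiv.prodComm _ _).hasSum_iff.2 (summable_pairTerm Y s ε).hasSum).prod_fiberwise
      fun w => ?_
    by_cases hw : IsStrict w
    · rw [if_pos hw, boundedGen, Finset.sum_mul]
      have h2 := hasSum_sum_of_ne_finset_zero (L := .unconditional _) (s := strictLists (w.length + s))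
        (f := fun v => pairTerm Y s ε (v, w)) fun v hv => if_neg fun h => hv
          (mem_strictLists.2 ⟨h.1, h.2.2⟩)
      convert! h2 using 1
      refine Finset.sum_congr rfl fun v hv => ?_
      rw [pairTerm, if_pos ⟨(mem_strictLists.1 hv).1, hw, (mem_strictLists.1 hv).2⟩]
    · rw [if_neg hw]
      refine hasSum_zero.congr_fun fun v => ?_
      exact if_neg fun h => hw h.2.1
  have h2 : HasSum (fun kw : ℕ × List ℕ => boundedGen Y (kw.1 + s) 1 * lengthTerm Y kw.1 ε kw.2)
      (∑' vw, pairTerm Y s ε vw) := by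
    have hinj : Function.Injective fun w : List ℕ => (w.length, w) := fun a b h =>
      congrArg Prod.snd h
    rw [← hinj.hasSum_iff]
    · refine h1.congr_fun fun w => ?_
      simp [lengthTerm]
    · rintro ⟨k, w⟩ hw
      rw [lengthTerm, if_neg, mul_zero]
      rintro ⟨-, h⟩
      exact hw ⟨w, Prod.ext h rfl⟩
  exact h2.prod_fiberwise fun k => (hasSum_lengthTerm Y k ε).mul_left (boundedGen Y (k + s) 1)

end Pairs

/-! ### The generating functions as sums over pairs of strict partitions. -/

section GenFun

/-- The unit `y`. -/
noncomputable def yUnit : ℚ[T;T⁻¹]ˣ where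
  val := LaurentPolynomial.T 1
  inv := LaurentPolynomial.T (-1)
  val_inv := by rw [← LaurentPolynomial.T_add]; simp
  inv_val := by rw [← LaurentPolynomial.T_add]; simp

theorem yUnit_zpow (n : ℤ) : ((yUnit ^ n : ℚ[T;T⁻¹]ˣ) : ℚ[T;T⁻¹]) = LaurentPolynomial.T n := by
  obtain ⟨m, rfl | rfl⟩ := n.eq_nat_or_neg
  · rw [zpow_natCast, Units.val_pow_eq_pow_val]
    simp [yUnit, LaurentPolynomial.T_pow]
  · rw [zpow_neg, ← inv_zpow, zpow_natCast, Units.val_pow_eq_pow_val]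
    simp [yUnit, LaurentPolynomial.T_pow]

variable [TopologicalSpace ℚ[T;T⁻¹]] [DiscreteTopology ℚ[T;T⁻¹]]

/-- Taking columns in both components is injective, and every pair of strict lists arises, so the
reindexing loses no nonzero term. -/
theorem genFun_eq_tsum_pairTerm {a s : ℕ} {ε : ℤ}
    (h0 : residueSign (charge a 2 0 : ZMod 2) = 1) (h1 : residueSign (charge a 2 1 : ZMod 2) = ε)
    (hs : charge a 2 1 = charge a 2 0 + s) :
    genFun a 2 = ∑' vw, pairTerm yUnit s ε vw := by
  classical
  have key : ∀ μ : Multipartition 2, pairTerm yUnit s ε (columns (μ 0), columns (μ 1)) =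
      if μ.IsRestricted 2 (charge a 2) then
        X ^ μ.size * PowerSeries.C (LaurentPolynomial.T (omega a μ)) else 0 := by
    intro μ
    have h2 : (IsStrict (columns (μ 0)) ∧ IsStrict (columns (μ 1)) ∧
        ∀ c ∈ columns (μ 0), c ≤ (columns (μ 1)).length + s) ↔
        μ.IsRestricted 2 (charge a 2) := by
      rw [Multipartition.IsRestricted, Fin.forall_fin_two, isRestricted_two_iff,
        isRestricted_two_iff, forall_mem_columns_le_iff, length_columns, and_assoc]
      refine and_congr_right fun _ => and_congr_right fun _ => ?_
      constructor
      · intro h s s' hss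
        have e1 : s = 0 := by ext; have := s'.2; simp; lia
        have e2 : s' = 1 := by ext; have := s.2; have := s'.2; simp; lia
        subst e1 e2
        rw [hs]
        lia
      · intro h
        have := h 0 1 rfl
        rw [hs] at this
        lia
    unfold pairTerm
    by_cases h : μ.IsRestricted 2 (charge a 2)
    · rw [if_pos (h2.2 h), if_pos h, weight, weight, mul_mul_mul_comm, ← pow_add, ← yPow_add,
        omega_eq, Multipartition.size, Fin.sum_univ_two, Fin.sum_univ_two, h0, h1,
        card_eq_sum_columns, card_eq_sum_columns, yPow, yUnit_zpow]
    · rw [if_neg fun h3 => h (h2.1 h3), if_neg h]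
  have hinj : Function.Injective fun μ : Multipartition 2 => (columns (μ 0), columns (μ 1)) := by
    intro μ ν h
    have h3 := columns_injective (congrArg Prod.fst h)
    have h4 := columns_injective (congrArg Prod.snd h)
    funext i
    fin_cases i
    · exact h3
    · exact h4
  have hsum := (summable_pairTerm yUnit s ε).hasSum
  rw [← hinj.hasSum_iff] at hsum
  · ext1 n
    have h3 := (PowerSeries.WithPiTopology.hasSum_iff_hasSum_coeff _).1 hsum n
    have h4 := hasSum_sum_of_ne_finset_zero (L := .unconditional _) (s := Lambda a 2 n) (f := fun μ : Multipartition 2 =>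
      PowerSeries.coeff n (pairTerm yUnit s ε (columns (μ 0), columns (μ 1)))) (by
        intro μ hμ
        rw [key]
        split_ifs with h
        · rw [mul_comm, PowerSeries.coeff_C_mul, PowerSeries.coeff_X_pow, if_neg, mul_zero]
          exact fun h5 => hμ ((LambdaSet_finite a 2 n).mem_toFinset.2 ⟨h, h5.symm⟩)
        · exact map_zero _)
    rw [h3.unique h4, genFun, PowerSeries.coeff_mk]
    refine Finset.sum_congr rfl fun μ hμ => ?_
    obtain ⟨h5, h6⟩ := (LambdaSet_finite a 2 n).mem_toFinset.1 hμ
    rw [key, if_pos h5, mul_comm, PowerSeries.coeff_C_mul, PowerSeries.coeff_X_pow, if_pos h6.symm,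
      mul_one]
  · rintro ⟨v, w⟩ hvw
    refine if_neg fun h => hvw ?_
    obtain ⟨μ, hμ⟩ := exists_columns_eq h.1
    obtain ⟨ν, hν⟩ := exists_columns_eq h.2.1
    exact ⟨![μ, ν], by simp [hμ, hν]⟩

theorem hasSum_genFun_one :
    HasSum (fun k => boundedGen yUnit (k + 1) 1 * lengthGen yUnit k (-1)) (genFun 1 2) := by
  rw [genFun_eq_tsum_pairTerm (s := 1) (ε := -1) (by simp [charge, residueSign])
    (by simp [charge, residueSign]) (by simp [charge])]
  exact hasSum_boundedGen_mul_lengthGen yUnit 1 (-1)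

theorem hasSum_genFun_two :
    HasSum (fun k => boundedGen yUnit k 1 * lengthGen yUnit k 1) (genFun 2 2) := by
  rw [genFun_eq_tsum_pairTerm (s := 0) (ε := 1) (by simp [charge, residueSign])
    (by simp [charge, residueSign]) (by simp [charge])]
  exact hasSum_boundedGen_mul_lengthGen yUnit 0 1

end GenFun

/-! ### Regrouping quadruple series. -/

section Quadruple

variable {A : Type*} [CommRing A] {p : A⟦X⟧}

theorem finite_setOf_add_lt (n : ℕ) : {x : ℕ × ℕ | x.1 + x.2 < n}.Finite := by
  refine ((Set.finite_Iio n).prod (Set.finite_Iio n)).subset fun x hx => ?_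
  simp only [Set.mem_prod, Set.mem_Iio, Set.mem_ofPred_eq] at *
  lia

variable [TopologicalSpace A]

theorem summable_of_X_pow_add_dvd {f : ℕ × ℕ → A⟦X⟧}
    (h : ∀ u v, (X : A⟦X⟧) ^ (u + v) ∣ f (u, v)) : Summable f :=
  summable_of_X_pow_dvd (fun x => x.1 + x.2) finite_setOf_add_lt fun x => h x.1 x.2

variable [DiscreteTopology A]

theorem hasSum_sum_antidiagonal_antidiagonal {f : (ℕ × ℕ) × (ℕ × ℕ) → A⟦X⟧} {S : A⟦X⟧}
    (hf : HasSum f S) :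
    HasSum (fun n => ∑ y ∈ antidiagonal n, ∑ z ∈ antidiagonal y.1, ∑ w ∈ antidiagonal y.2,
      f ((z.1, w.2), (z.2, w.1))) S := by
  let e : (ℕ × ℕ) × (ℕ × ℕ) ≃ (ℕ × ℕ) × (ℕ × ℕ) :=
    { toFun := fun zw => ((zw.1.1, zw.2.2), (zw.1.2, zw.2.1))
      invFun := fun zw => ((zw.1.1, zw.2.1), (zw.2.2, zw.1.2))
      left_inv := fun _ => rfl
      right_inv := fun _ => rfl }
  have h1 := hasSum_sum_fiber (e.hasSum_iff.2 hf) (fun zw => (zw.1.1 + zw.1.2, zw.2.1 + zw.2.2))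
    (fun y => antidiagonal y.1 ×ˢ antidiagonal y.2) (by simp [Prod.ext_iff])
  refine (hasSum_sum_antidiagonal h1).congr_fun fun n => ?_
  exact Finset.sum_congr rfl fun y _ => by rw [Finset.sum_product]; rfl

/-- A double series of products of Euler series, as a quadruple series. -/
theorem hasSum_quadruple (hp : X ∣ p) {K : ℕ → ℕ → A⟦X⟧} (hK : ∀ u v, X ^ (u + v) ∣ K u v)
    (z z' : ℕ → A⟦X⟧) :
    HasSum (fun n => ∑ y ∈ antidiagonal n, ∑ a ∈ antidiagonal y.1, ∑ b ∈ antidiagonal y.2,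
      K a.1 b.2 * ((p ^ a.2.choose 2 * z a.1 ^ a.2 * qfacInv p a.2) *
        (p ^ b.1.choose 2 * z' b.2 ^ b.1 * qfacInv p b.1)))
      (∑' x : ℕ × ℕ, K x.1 x.2 * (eulerSeries p (z x.1) * eulerSeries p (z' x.2))) := by
  set f : (ℕ × ℕ) × (ℕ × ℕ) → A⟦X⟧ := fun x => K x.1.1 x.1.2 *
    ((p ^ x.2.1.choose 2 * z x.1.1 ^ x.2.1 * qfacInv p x.2.1) *
        (p ^ x.2.2.choose 2 * z' x.1.2 ^ x.2.2 * qfacInv p x.2.2)) with hf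
  have hle : ∀ n : ℕ, n - 1 ≤ n.choose 2 := fun n => by
    rcases n with _ | n
    · simp
    · exact le_choose_two_succ n
  have hdvd : ∀ (r : ℕ) (t : A⟦X⟧), X ^ (r - 1) ∣ p ^ r.choose 2 * t ^ r * qfacInv p r :=
    fun r t => Dvd.dvd.mul_right (Dvd.dvd.mul_right (X_pow_dvd_pow hp (hle r)) _) _
  have h1 : Summable f := by
    -- The Euler exponent `r.choose 2` vanishes at `r = 1`, so only `r - 1` is guaranteed for each
    -- index; this accounts for the bound `n + 2` below.
    refine summable_of_X_pow_dvd (fun x => (x.1.1 + x.1.2) + ((x.2.1 - 1) + (x.2.2 - 1)))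
      (fun n => ((finite_setOf_add_lt n).prod (finite_setOf_add_lt (n + 2))).subset
        fun x hx => ?_) fun x => ?_
    · simp only [Set.mem_prod, Set.mem_ofPred_eq] at *
      lia
    · rw [pow_add, pow_add (X : A⟦X⟧) (x.2.1 - 1)]
      exact mul_dvd_mul (hK _ _) (mul_dvd_mul (hdvd _ _) (hdvd _ _))
  have h2 : ∀ u v, HasSum (fun rs : ℕ × ℕ => f ((u, v), rs))
      (K u v * (eulerSeries p (z u) * eulerSeries p (z' v))) := by
    intro u v
    have h0 : Summable fun x : ℕ × ℕ => p ^ x.1.choose 2 * z u ^ x.1 * qfacInv p x.1 *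
        (p ^ x.2.choose 2 * z' v ^ x.2 * qfacInv p x.2) := by
      refine summable_of_X_pow_dvd (fun x => (x.1 - 1) + (x.2 - 1))
        (fun n => (finite_setOf_add_lt (n + 2)).subset fun x hx => ?_) fun x => ?_
      · simp only [Set.mem_ofPred_eq] at *
        lia
      · rw [pow_add]
        exact mul_dvd_mul (hdvd _ _) (hdvd _ _)
    exact ((hasSum_eulerSeries hp (z u)).mul (hasSum_eulerSeries hp (z' v)) h0).mul_left (K u v)
  have h3 : HasSum (fun x : ℕ × ℕ => K x.1 x.2 * (eulerSeries p (z x.1) * eulerSeries p (z' x.2)))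
      (∑' x, f x) := h1.hasSum.prod_fiberwise fun x => h2 x.1 x.2
  have h4 := hasSum_sum_antidiagonal_antidiagonal h1.hasSum
  rw [← h3.tsum_eq] at h4
  exact h4

end Quadruple

/-! ### The summands over `k` as quadruple sums. -/

section Products

variable {A : Type*} [CommRing A] (Y : Aˣ)

theorem X_pow_two_pow_choose_mul (r : ℕ) : ((X : A⟦X⟧) ^ 2) ^ r.choose 2 * X ^ r = X ^ (r ^ 2) := by
  rw [← pow_mul, ← pow_add, two_mul_choose_two, sq]

/-- The quadruple series of the case `a = 2`. -/
noncomputable def quadTermTwo (t : A⟦X⟧) (u v r s : ℕ) : A⟦X⟧ :=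
  t ^ (u + v) * X ^ ((u + v) ^ 2 + (u + v)) * (qfacInv (X ^ 2) u * qfacInv (X ^ 2) v) *
    (yPow Y ((u : ℤ) - v) + t * yPow Y (1 - ((u : ℤ) - v))) *
    (((X ^ 2) ^ r.choose 2 * (t * X * (X ^ 2) ^ u) ^ r * qfacInv (X ^ 2) r) *
      ((X ^ 2) ^ s.choose 2 * (t * X * (X ^ 2) ^ (v + 1)) ^ s * qfacInv (X ^ 2) s))

/-- Links the Euler-series form, which can be summed over `r` and `s`, to the form produced by the
q-Vandermonde expansion. -/
theorem quadTermTwo_eq (t : A⟦X⟧) (u v r s : ℕ) : quadTermTwo Y t u v r s =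
    qfacInv (X ^ 2) u * qfacInv (X ^ 2) r * (qfacInv (X ^ 2) s * qfacInv (X ^ 2) v) *
      X ^ (2 * (u * v) + (u + s) + ((u + r) ^ 2 + (s + v) ^ 2 + (s + v))) *
      (t ^ (u + v + r + s) * (yPow Y ((u : ℤ) - v) + t * yPow Y (1 - ((u : ℤ) - v)))) := by
  have h : (X : A⟦X⟧) ^ (2 * (u * v) + (u + s) + ((u + r) ^ 2 + (s + v) ^ 2 + (s + v))) =
      X ^ ((u + v) ^ 2 + (u + v)) * (((X ^ 2) ^ r.choose 2 * X ^ r) * (X ^ 2) ^ (u * r)) *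
        (((X ^ 2) ^ s.choose 2 * X ^ s) * (X ^ 2) ^ ((v + 1) * s)) := by
    rw [X_pow_two_pow_choose_mul, X_pow_two_pow_choose_mul]
    ring
  rw [h, quadTermTwo]
  simp only [mul_pow, ← pow_mul, pow_add t]
  ring

/-- Replaces a parity condition by a sum over `t = ±1`, so that each resulting series runs over all
quadruples. -/
theorem two_mul_ite_even (n : ℕ) (a b : A⟦X⟧) :
    2 * (if Even n then a else b) =
      (1 : A⟦X⟧) ^ n * (a + 1 * b) + (-1) ^ n * (a + -1 * b) := by
  split_ifs with h
  · rw [h.neg_one_pow]; ring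
  · rw [(Nat.not_even_iff_odd.1 h).neg_one_pow]; ring

/-- For each parity of `k`, the dependence on `r` and `s` drops out; this is what makes them free
Euler summation indices. -/
theorem yExp_add_yExp {k u v r s : ℕ} (h : u + v + r + s = k) :
    yExp k (u + s) + yExp k (u + r) = if Even k then (u : ℤ) - v else 1 - ((u : ℤ) - v) := by
  subst h
  unfold yExp
  split_ifs with h
  · obtain ⟨m, hm⟩ := h
    lia
  · obtain ⟨m, hm⟩ := Nat.not_even_iff_odd.1 h
    lia

/-- The quadruple series of the case `a = 1`. -/
noncomputable def quadTermOne (t : A⟦X⟧) (u v r s : ℕ) : A⟦X⟧ :=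
  t ^ (u + v) * X ^ ((u + v) ^ 2) * (qfacInv (X ^ 2) u * qfacInv (X ^ 2) v) *
    (yPow Y ((u : ℤ) - v) + t * yPow Y (v - u)) * (1 - (X ^ 2) ^ (r + v)) *
    (((X ^ 2) ^ r.choose 2 * (t * (X ^ 2) ^ u) ^ r * qfacInv (X ^ 2) r) *
      ((X ^ 2) ^ s.choose 2 * (t * (X ^ 2) ^ (v + 1)) ^ s * qfacInv (X ^ 2) s))

theorem X_pow_mul_quadTermOne (t : A⟦X⟧) (u v r s : ℕ) :
    X ^ (u + v + r + s) * quadTermOne Y t u v r s =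
    qfacInv (X ^ 2) u * qfacInv (X ^ 2) r * (qfacInv (X ^ 2) s * qfacInv (X ^ 2) v) *
      X ^ (2 * (u * v) + (u + s) + ((u + r) ^ 2 + (s + v) ^ 2 + (s + v))) *
      (1 - (X ^ 2) ^ (r + v)) *
      (t ^ (u + v + r + s) * (yPow Y ((u : ℤ) - v) + t * yPow Y (v - u))) := by
  have h : (X : A⟦X⟧) ^ (2 * (u * v) + (u + s) + ((u + r) ^ 2 + (s + v) ^ 2 + (s + v))) =
      X ^ (u + v) * X ^ ((u + v) ^ 2) * (((X ^ 2) ^ r.choose 2 * X ^ r) * (X ^ 2) ^ (u * r)) *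
        (((X ^ 2) ^ s.choose 2 * X ^ s) * (X ^ 2) ^ ((v + 1) * s)) := by
    rw [X_pow_two_pow_choose_mul, X_pow_two_pow_choose_mul]
    ring
  rw [h, quadTermOne]
  simp only [mul_pow, ← pow_mul, pow_add t, pow_add (X : A⟦X⟧) (u + v + r),
    pow_add (X : A⟦X⟧) (u + v) r]
  ring

theorem yExp_add_yExp_pred {k u v r s : ℕ} (h : u + v + r + s = k + 1) :
    -1 * yExp k (u + s) + yExp (k + 1) (u + r) = if Even (k + 1) then (u : ℤ) - v else v - u := by
  have h1 := yExp_add_yExp h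
  rw [yExp_succ k (u + s)] at h1
  rcases Nat.even_or_odd (k + 1) with h2 | h2
  · rw [if_pos h2] at *
    have := Nat.even_iff.1 h2
    lia
  · rw [if_neg (Nat.not_even_iff_odd.2 h2)] at *
    have := Nat.odd_iff.1 h2
    lia

variable [TopologicalSpace A] [DiscreteTopology A]

theorem two_mul_boundedGen_mul_lengthGen (k : ℕ) :
    2 * (boundedGen Y k 1 * lengthGen Y k 1) =
      ∑ y ∈ antidiagonal k, ∑ a ∈ antidiagonal y.1, ∑ b ∈ antidiagonal y.2,
        (quadTermTwo Y 1 a.1 b.2 a.2 b.1 + quadTermTwo Y (-1) a.1 b.2 a.2 b.1) := by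
  have h1 : boundedGen Y k 1 * lengthGen Y k 1 = qfacInv (X ^ 2) k *
      gaussSum (X ^ 2) k (fun a _ => X ^ a * yPow Y (1 * yExp k a)) *
      gaussSum (X ^ 2) k fun b c => X ^ (b ^ 2 + c ^ 2 + c) * yPow Y (1 * yExp k b) := by
    rw [← X_pow_mul_boundedGen, lengthGen_eq]
    ring
  rw [h1, qfacInv_mul_gaussSum_mul_gaussSum X_dvd_X_sq, Finset.mul_sum]
  refine Finset.sum_congr rfl fun y hy => ?_
  rw [Finset.mul_sum]
  refine Finset.sum_congr rfl fun a ha => ?_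
  rw [Finset.mul_sum]
  refine Finset.sum_congr rfl fun b hb => ?_
  rw [Finset.HasAntidiagonal.mem_antidiagonal] at hy ha hb
  rw [quadTermTwo_eq, quadTermTwo_eq, ← mul_add, ← two_mul_ite_even, ← apply_ite (yPow Y),
    ← yExp_add_yExp rfl, yPow_add, show a.1 + b.2 + a.2 + b.1 = k by lia, ← ha, ← hb, one_mul,
    one_mul]
  ring

/-- The two Gaussian sums have sizes `k + 1` and `k`. Raising the second with `qfacInv_mul_gaussSum`
costs the factor `1 - q ^ (r + v)` in `quadTermOne`. -/
theorem two_mul_boundedGen_succ_mul_lengthGen (k : ℕ) :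
    2 * (boundedGen Y (k + 1) 1 * lengthGen Y k (-1)) =
      ∑ y ∈ antidiagonal (k + 1), ∑ a ∈ antidiagonal y.1, ∑ b ∈ antidiagonal y.2,
        (quadTermOne Y 1 a.1 b.2 a.2 b.1 + quadTermOne Y (-1) a.1 b.2 a.2 b.1) := by
  have h1 : X ^ (k + 1) * (boundedGen Y (k + 1) 1 * lengthGen Y k (-1)) =
      qfacInv (X ^ 2) (k + 1) *
      gaussSum (X ^ 2) (k + 1)
        (fun a b => (1 - (X ^ 2) ^ b) * (X ^ a * yPow Y (-1 * yExp k a))) *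
      gaussSum (X ^ 2) (k + 1) fun b c =>
        X ^ (b ^ 2 + c ^ 2 + c) * yPow Y (1 * yExp (k + 1) b) := by
    rw [← X_pow_mul_boundedGen, lengthGen_eq, qfacInv_mul_gaussSum X_dvd_X_sq,
      choose_two_succ (k + 1)]
    ring
  -- `lengthGen Y k` supplies `X ^ (k + 1).choose 2`, while `boundedGen Y (k + 1)` needs `X ^ (k +
  -- 2).choose 2`; the shortfall is `X ^ (k + 1)`.
  refine PowerSeries.X_pow_mul_cancel (k := k + 1) ?_
  rw [mul_left_comm, h1, qfacInv_mul_gaussSum_mul_gaussSum X_dvd_X_sq, Finset.mul_sum,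
    Finset.mul_sum]
  refine Finset.sum_congr rfl fun y hy => ?_
  rw [Finset.mul_sum, Finset.mul_sum]
  refine Finset.sum_congr rfl fun a ha => ?_
  rw [Finset.mul_sum, Finset.mul_sum]
  refine Finset.sum_congr rfl fun b hb => ?_
  rw [Finset.HasAntidiagonal.mem_antidiagonal] at hy ha hb
  have hk : a.1 + b.2 + a.2 + b.1 = k + 1 := by lia
  rw [← hk, mul_add, X_pow_mul_quadTermOne, X_pow_mul_quadTermOne, ← mul_add, ← two_mul_ite_even,
    ← apply_ite (yPow Y), hk, ← yExp_add_yExp_pred hk, yPow_add, ← ha, ← hb, one_mul]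
  ring

end Products

/-! ### Theta coefficients and changes of base. -/

section Evaluation

variable {A : Type*} [CommRing A] (Y : Aˣ)

/-- The `- 1` is needed for `thetaTwo`, whose exponent `N * N - N` vanishes at `N = 1`. -/
theorem X_pow_natAbs_finite {c : ℤ → A⟦X⟧} (h : ∀ N : ℤ, (X : A⟦X⟧) ^ (N.natAbs - 1) ∣ c N) (n : ℕ) :
    {N | ¬ (X : A⟦X⟧) ^ n ∣ c N}.Finite := by
  refine (Set.finite_Icc (-(n + 1) : ℤ) (n + 1)).subset fun N hN => ?_
  by_contra h1
  refine hN ((pow_dvd_pow _ ?_).trans (h N))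
  rw [Set.mem_Icc] at h1
  lia

/-- The theta coefficients of the case `a = 1`. -/
noncomputable def thetaOne (N : ℤ) : A⟦X⟧ := X ^ (N.natAbs ^ 2) * yPow Y N

/-- The theta coefficients of the case `a = 2`. -/
noncomputable def thetaTwo (t : A⟦X⟧) (N : ℤ) : A⟦X⟧ :=
  t ^ N.natAbs * yPow Y N * X ^ (N * N - N).toNat

theorem finite_thetaOne (n : ℕ) : {N | ¬ (X : A⟦X⟧) ^ n ∣ thetaOne Y N}.Finite :=
  X_pow_natAbs_finite (fun N => Dvd.dvd.mul_right (pow_dvd_pow _ (by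
    have := Nat.le_self_pow two_ne_zero N.natAbs
    lia)) _) n

theorem natAbs_sub_one_le (N : ℤ) : N.natAbs - 1 ≤ (N * N - N).toNat := by
  obtain ⟨m, rfl | rfl⟩ := N.eq_nat_or_neg
  · rcases m with _ | m
    · simp
    · have h : ((m + 1 : ℕ) : ℤ) * (m + 1 : ℕ) - (m + 1 : ℕ) = ((m + 1) * m : ℕ) := by
        push_cast; ring
      rw [h, Int.toNat_natCast, Int.natAbs_natCast]
      exact Nat.le_mul_of_pos_left m (Nat.succ_pos m)
  · have h : (-(m : ℤ)) * -(m : ℤ) - -(m : ℤ) = (m * m + m : ℕ) := by push_cast; ring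
    rw [h, Int.toNat_natCast, Int.natAbs_neg, Int.natAbs_natCast]
    lia

theorem finite_thetaTwo (t : A⟦X⟧) (n : ℕ) : {N | ¬ (X : A⟦X⟧) ^ n ∣ thetaTwo Y t N}.Finite :=
  X_pow_natAbs_finite (fun N => Dvd.dvd.mul_left (pow_dvd_pow _ (natAbs_sub_one_le N)) _) n

theorem pow_natAbs_sub {t : A⟦X⟧} (ht : t * t = 1) (a b : ℕ) :
    t ^ ((a : ℤ) - b).natAbs = t ^ (a + b) := by
  have h2 : t ^ 2 = 1 := by rw [sq, ht]
  rcases le_total a b with h | h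
  · obtain ⟨d, rfl⟩ := Nat.exists_eq_add_of_le h
    rw [show ((a : ℤ) - (a + d : ℕ)).natAbs = d by lia, show a + (a + d) = 2 * a + d by ring,
      pow_add, pow_mul, h2, one_pow, one_mul]
  · obtain ⟨d, rfl⟩ := Nat.exists_eq_add_of_le h
    rw [show (((b + d : ℕ) : ℤ) - b).natAbs = d by lia, show b + d + b = 2 * b + d by ring,
      pow_add, pow_mul, h2, one_pow, one_mul]

theorem X_pow_toNat (a b : ℕ) {N : ℤ} (h : (a : ℤ) + (N * N - N) = (b : ℤ)) :
    (X : A⟦X⟧) ^ a * X ^ (N * N - N).toNat = X ^ b := by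
  rw [← pow_add]
  congr 1
  have : 0 ≤ N * N - N := by nlinarith [Int.le_self_sq N]
  lia

theorem yPow_sub (a b : ℕ) : yPow Y ((a : ℤ) - b) = yPow Y 1 ^ a * yPow Y (-1) ^ b := by
  have h : ∀ (n : ℤ) (m : ℕ), yPow Y (m * n) = yPow Y n ^ m := by
    intro n m
    induction m with
    | zero => simp [yPow_zero]
    | succ m ih => rw [pow_succ, ← ih, ← yPow_add]; push_cast; ring_nf
  rw [← h, ← h, ← yPow_add]
  ring_nf

section EulerFactors

theorem qfac_neg_mul_X_two_mul {t : A⟦X⟧} (ht : t * t = 1) (u : ℕ) : qfac (-(t * X)) (2 * u) =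
    (∏ i ∈ Finset.range u, (1 + t * X * (X ^ 2) ^ i)) * qfac (X ^ 2) u := by
  have h2 : (-(t * X)) ^ 2 = X ^ 2 := by rw [neg_sq, mul_pow, sq t, ht, one_mul]
  induction u with
  | zero => simp [qfac]
  | succ u ih =>
    rw [show 2 * (u + 1) = 2 * u + 1 + 1 by ring, qfac_succ, qfac_succ, ih, Finset.prod_range_succ,
      qfac_succ, pow_succ _ (2 * u), show 2 * u + 1 + 1 = 2 * (u + 1) by ring, pow_mul, pow_mul, h2]
    ring

theorem X_dvd_neg_mul_X (t : A⟦X⟧) : X ∣ -(t * X) := (dvd_neg.2 (dvd_mul_left _ _))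

variable [TopologicalSpace A] [DiscreteTopology A]

/-- With `P = -(t * X)` and `P ^ 2 = X ^ 2`, the even-indexed factors of `(P; P)_{2u}` form `(X ^ 2;
X ^ 2)_u` and the odd-indexed ones are the initial factors of `eulerSeries (X ^ 2) (t * X)`. -/
theorem qfacInv_mul_eulerSeries_even {t : A⟦X⟧} (ht : t * t = 1) (u : ℕ) :
    qfacInv (X ^ 2) u * eulerSeries (X ^ 2) (t * X * (X ^ 2) ^ u) =
      eulerSeries (X ^ 2) (t * X) * qfacInv (-(t * X)) (2 * u) := by
  have h1 := eulerSeries_eq_prod_mul X_dvd_X_sq (t * X) u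
  have h2 := qfac_mul_qfacInv (X_dvd_neg_mul_X t) (2 * u)
  rw [qfac_neg_mul_X_two_mul ht] at h2
  have h3 := qfac_mul_qfacInv (X_dvd_X_sq (A := A)) u
  rw [h1]
  linear_combination (-qfacInv (X ^ 2) u * eulerSeries (X ^ 2) (t * X * (X ^ 2) ^ u)) * h2 +
    (∏ i ∈ Finset.range u, (1 + t * X * (X ^ 2) ^ i)) * qfacInv (-(t * X)) (2 * u) *
      eulerSeries (X ^ 2) (t * X * (X ^ 2) ^ u) * h3

theorem qfacInv_mul_eulerSeries_odd {t : A⟦X⟧} (ht : t * t = 1) (v : ℕ) :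
    qfacInv (X ^ 2) v * eulerSeries (X ^ 2) (t * X * (X ^ 2) ^ (v + 1)) =
      eulerSeries (X ^ 2) (t * X) * qfacInv (-(t * X)) (2 * v + 1) := by
  have h0 : (-(t * X)) ^ 2 = X ^ 2 := by rw [neg_sq, mul_pow, sq t, ht, one_mul]
  have h1 := qfacInv_mul_eulerSeries_even ht v
  have h2 := one_sub_mul_qfacInv_succ (X_dvd_neg_mul_X t) (2 * v)
  have h3 := eulerSeries_eq X_dvd_X_sq (t * X * (X ^ 2) ^ v)
  -- The factor `1 + t * X * (X ^ 2) ^ v` is `1 - P ^ (2 * v + 1)` for `P = -(t * X)`; it divides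
  -- `(P; P)_{2v+1}`, so `h5` permits cancelling it.
  have h4 : qfacInv (X ^ 2) v * eulerSeries (X ^ 2) (t * X * (X ^ 2) ^ v * X ^ 2) *
      (1 + t * X * (X ^ 2) ^ v) = eulerSeries (X ^ 2) (t * X) * qfacInv (-(t * X)) (2 * v + 1) *
      (1 + t * X * (X ^ 2) ^ v) := by
    rw [pow_succ, pow_mul, h0] at h2
    linear_combination h1 - qfacInv (X ^ 2) v * h3 - eulerSeries (X ^ 2) (t * X) * h2
  have h5 := qfac_mul_qfacInv (X_dvd_neg_mul_X t) (2 * v + 1)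
  rw [qfac_succ, pow_succ, pow_mul, h0] at h5
  rw [pow_succ _ v, ← mul_assoc]
  linear_combination (qfac (-(t * X)) (2 * v) * qfacInv (-(t * X)) (2 * v + 1)) * h4 -
    (qfacInv (X ^ 2) v * eulerSeries (X ^ 2) (t * X * (X ^ 2) ^ v * X ^ 2) -
      eulerSeries (X ^ 2) (t * X) * qfacInv (-(t * X)) (2 * v + 1)) * h5

/-- If `e_u E_u = O e'_{u}` for all `u`, then the limits agree. -/
theorem cauchySeries_eq_mul {p p' O : A⟦X⟧} (hp : X ∣ p) (hp' : X ∣ p') {E : ℕ → A⟦X⟧}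
    {g : ℕ → ℕ} (hg : ∀ u, u ≤ g u) (hE : ∀ u, X ^ u ∣ E u - 1)
    (h : ∀ u, qfacInv p u * E u = O * qfacInv p' (g u)) :
    cauchySeries p 0 = O * cauchySeries p' 0 := by
  refine eq_of_forall_X_pow_dvd_sub fun u => ?_
  have h1 := X_pow_dvd_cauchySeries_sub hp u
  have h2 := (pow_dvd_pow X (hg u)).trans (X_pow_dvd_cauchySeries_sub hp' (g u))
  rw [cauchySeries_eq_zero hp] at h1
  rw [cauchySeries_eq_zero hp'] at h2
  have h3 : cauchySeries p 0 - O * cauchySeries p' 0 =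
      (cauchySeries p 0 - qfacInv p u) - qfacInv p u * (E u - 1) -
        O * (cauchySeries p' 0 - qfacInv p' (g u)) := by
    linear_combination h u
  rw [h3]
  exact dvd_sub (dvd_sub h1 (Dvd.dvd.mul_left (hE u) _)) (Dvd.dvd.mul_left h2 _)

theorem cauchySeries_X_sq_eq {t : A⟦X⟧} (ht : t * t = 1) : cauchySeries (X ^ 2) 0 =
    eulerSeries (X ^ 2) (t * X) * cauchySeries (-(t * X)) 0 :=
  cauchySeries_eq_mul X_dvd_X_sq (X_dvd_neg_mul_X t) (g := fun u => 2 * u) (fun u => by lia)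
    (fun u => X_pow_dvd_eulerSeries_sub_one X_dvd_X_sq
      (Dvd.dvd.mul_left (X_pow_dvd_pow X_dvd_X_sq le_rfl) _))
    (qfacInv_mul_eulerSeries_even ht)

/-- From `1 - p ^ (2 * i) = (1 - p ^ i) * (1 + p ^ i)`: the Euler factor changes the base from `p`
to `p ^ 2`. -/
theorem qfacInv_mul_eulerSeries_succ {p : A⟦X⟧} (hp : X ∣ p) (u : ℕ) :
    qfacInv p u * eulerSeries p (p ^ (u + 1)) = eulerSeries p p * qfacInv (p ^ 2) u := by
  have hp2 : X ∣ p ^ 2 := dvd_pow hp two_ne_zero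
  have h1 := eulerSeries_eq_prod_mul hp p u
  have h2 : qfac (p ^ 2) u = qfac p u * ∏ i ∈ Finset.range u, (1 + p * p ^ i) := by
    rw [qfac, qfac, ← Finset.prod_mul_distrib]
    exact Finset.prod_congr rfl fun i _ => by ring
  have h3 := qfac_mul_qfacInv hp u
  have h4 := qfac_mul_qfacInv hp2 u
  rw [h2] at h4
  rw [h1, pow_succ']
  linear_combination (-qfacInv p u * eulerSeries p (p * p ^ u)) * h4 +
    (∏ i ∈ Finset.range u, (1 + p * p ^ i)) * qfacInv (p ^ 2) u * eulerSeries p (p * p ^ u) * h3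

theorem cauchySeries_eq_eulerSeries_mul {p : A⟦X⟧} (hp : X ∣ p) :
    cauchySeries p 0 = eulerSeries p p * cauchySeries (p ^ 2) 0 :=
  cauchySeries_eq_mul hp (dvd_pow hp two_ne_zero) (g := fun u => u) (fun _ => le_rfl)
    (fun u => X_pow_dvd_eulerSeries_sub_one hp (X_pow_dvd_pow hp (Nat.le_succ u)))
    (qfacInv_mul_eulerSeries_succ hp)

theorem eulerSeries_mul_eulerSeries_thetaTwo {t : A⟦X⟧} (ht : t * t = 1) :
    eulerSeries (X ^ 2) (t * yPow Y 1) * eulerSeries (X ^ 2) (t * yPow Y (-1) * X ^ 2) =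
      cauchySeries (X ^ 2) 0 * ∑' N, thetaTwo Y t N := by
  refine eulerSeries_mul_eulerSeries X_dvd_X_sq (fun a b => ?_) (finite_thetaTwo Y t)
  rw [thetaTwo, pow_natAbs_sub ht, yPow_sub]
  have h := X_pow_toNat (A := A) (2 * (a * b)) (2 * a.choose 2 + 2 * b.choose 2 + 2 * b)
    (N := (a : ℤ) - b) (by
      have h1 : (2 * a.choose 2 + a : ℤ) = a * a := by exact_mod_cast two_mul_choose_two a
      have h2 : (2 * b.choose 2 + b : ℤ) = b * b := by exact_mod_cast two_mul_choose_two b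
      push_cast
      linear_combination -h1 - h2)
  rw [← pow_mul, ← pow_mul, ← pow_mul]
  rw [mul_pow, mul_pow, mul_pow, ← pow_mul]
  rw [pow_add, pow_add] at h
  rw [pow_add]
  linear_combination (-t ^ a * t ^ b * yPow Y 1 ^ a * yPow Y (-1) ^ b) * h

theorem eulerSeries_mul_eulerSeries_thetaOne :
    eulerSeries (X ^ 2) (yPow Y 1 * X) * eulerSeries (X ^ 2) (yPow Y (-1) * X) =
      cauchySeries (X ^ 2) 0 * ∑' N, thetaOne Y N := by
  refine eulerSeries_mul_eulerSeries X_dvd_X_sq (fun a b => ?_) (finite_thetaOne Y)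
  rw [thetaOne, yPow_sub]
  have h : ((X : A⟦X⟧) ^ 2) ^ (a * b) * X ^ (((a : ℤ) - b).natAbs ^ 2) =
      X ^ a ^ 2 * X ^ b ^ 2 := by
    rw [← pow_mul, ← pow_add, ← pow_add]
    congr 1
    zify
    rw [sq_abs]
    ring
  rw [← X_pow_two_pow_choose_mul a, ← X_pow_two_pow_choose_mul b] at h
  rw [mul_pow, mul_pow]
  linear_combination (-yPow Y 1 ^ a * yPow Y (-1) ^ b) * h

end EulerFactors

end Evaluation

/-! ### Evaluation of the double series. -/

section DoubleSums

variable {A : Type*} [CommRing A] (Y : Aˣ)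

/-- The theta coefficients of the case `a = 2`, placed at the odd integers `2 N - 1`. -/
noncomputable def oddTheta (t : A⟦X⟧) (d : ℤ) : A⟦X⟧ :=
  if Odd d then thetaTwo Y t ((d + 1) / 2) else 0

theorem oddTheta_two_mul_sub_one (t : A⟦X⟧) (N : ℤ) :
    oddTheta Y t (2 * N - 1) = thetaTwo Y t N := by
  rw [oddTheta, if_pos ⟨N - 1, by ring⟩, show (2 * N - 1 + 1) / 2 = N by lia]

theorem injective_two_mul_sub_one : Function.Injective fun N : ℤ => 2 * N - 1 := fun a b h => by
  simp only at h
  lia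

theorem oddTheta_eq_zero {t : A⟦X⟧} {d : ℤ} (h : d ∉ Set.range fun N : ℤ => 2 * N - 1) :
    oddTheta Y t d = 0 := by
  refine if_neg fun ⟨m, hm⟩ => h ⟨m + 1, ?_⟩
  rw [hm]
  ring

theorem finite_oddTheta (t : A⟦X⟧) (n : ℕ) : {d | ¬ (X : A⟦X⟧) ^ n ∣ oddTheta Y t d}.Finite := by
  refine ((finite_thetaTwo Y t n).image fun N : ℤ => 2 * N - 1).subset fun d hd => ?_
  by_cases h : d ∈ Set.range fun N : ℤ => 2 * N - 1
  · obtain ⟨N, rfl⟩ := h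
    refine ⟨N, ?_, rfl⟩
    rwa [Set.mem_ofPred_eq, oddTheta_two_mul_sub_one] at hd
  · exact absurd (by rw [oddTheta_eq_zero Y h]; exact dvd_zero _) hd

/-- The pairs of natural numbers of different parity. -/
def oddPair (x : (ℕ × ℕ) × Bool) : ℕ × ℕ :=
  if x.2 then (2 * x.1.1, 2 * x.1.2 + 1) else (2 * x.1.2 + 1, 2 * x.1.1)

theorem oddPair_injective : Function.Injective oddPair := by
  rintro ⟨⟨a, b⟩, i⟩ ⟨⟨c, d⟩, j⟩ h
  cases i <;> cases j <;> simp [oddPair] at h ⊢ <;> lia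

theorem mem_range_oddPair {x : ℕ × ℕ} (h : Odd ((x.1 : ℤ) - x.2)) : x ∈ Set.range oddPair := by
  obtain ⟨m, hm⟩ := h
  rcases Nat.even_or_odd' x.1 with ⟨u, hu | hu⟩
  · refine ⟨((u, x.2 / 2), true), Prod.ext ?_ ?_⟩ <;> simp [oddPair] <;> lia
  · refine ⟨((x.2 / 2, u), false), Prod.ext ?_ ?_⟩ <;> simp [oddPair] <;> lia

theorem neg_mul_X_pow {t : A⟦X⟧} (ht : t * t = 1) (m : ℕ) : (-(t * X)) ^ (2 * m) = X ^ (2 * m) := by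
  rw [pow_mul, neg_sq, mul_pow, sq t, ht, one_mul, pow_mul]

/-- The pairs `(2u, 2v + 1)` and `(2v + 1, 2u)` have theta indices `u - v` and `1 - (u - v)`: these
are the two `y`-terms attached to `(u, v)`. -/
theorem oddTheta_oddPair_add {t : A⟦X⟧} (ht : t * t = 1) (u v : ℕ) :
    (-(t * X)) ^ (2 * u * (2 * v + 1)) * oddTheta Y t ((2 * u : ℕ) - (2 * v + 1 : ℕ)) +
      (-(t * X)) ^ ((2 * v + 1) * (2 * u)) * oddTheta Y t ((2 * v + 1 : ℕ) - (2 * u : ℕ)) =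
    t ^ (u + v) * X ^ ((u + v) ^ 2 + (u + v)) *
      (yPow Y ((u : ℤ) - v) + t * yPow Y (1 - ((u : ℤ) - v))) := by
  have h1 : ((2 * u : ℕ) - (2 * v + 1 : ℕ) : ℤ) = 2 * ((u : ℤ) - v) - 1 := by push_cast; ring
  have h2 : ((2 * v + 1 : ℕ) - (2 * u : ℕ) : ℤ) = 2 * (((v + 1 : ℕ) : ℤ) - u) - 1 := by
    push_cast; ring
  rw [h1, h2, oddTheta_two_mul_sub_one, oddTheta_two_mul_sub_one,
    show (2 * v + 1) * (2 * u) = 2 * (u * (2 * v + 1)) by ring,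
    show 2 * u * (2 * v + 1) = 2 * (u * (2 * v + 1)) by ring, neg_mul_X_pow ht, thetaTwo, thetaTwo,
    pow_natAbs_sub ht, pow_natAbs_sub ht]
  have h3 := X_pow_toNat (A := A) (2 * (u * (2 * v + 1))) ((u + v) ^ 2 + (u + v))
    (N := (u : ℤ) - v) (by push_cast; ring)
  have h4 := X_pow_toNat (A := A) (2 * (u * (2 * v + 1))) ((u + v) ^ 2 + (u + v))
    (N := ((v + 1 : ℕ) : ℤ) - u) (by push_cast; ring)
  rw [show (1 - ((u : ℤ) - v)) = ((v + 1 : ℕ) : ℤ) - u by push_cast; ring,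
    show v + 1 + u = u + v + 1 by ring, pow_succ t]
  linear_combination t ^ (u + v) * yPow Y ((u : ℤ) - v) * h3 +
    t ^ (u + v) * t * yPow Y (((v + 1 : ℕ) : ℤ) - u) * h4

variable [TopologicalSpace A]

/-- The symmetric part of the double series of the case `a = 1`. -/
noncomputable def symmTerm (t : A⟦X⟧) (u v : ℕ) : A⟦X⟧ :=
  t ^ (u + v) * X ^ ((u + v) ^ 2) * (qfacInv (X ^ 2) u * qfacInv (X ^ 2) v) *
    (eulerSeries (X ^ 2) (t * (X ^ 2) ^ (u + 1)) * eulerSeries (X ^ 2) (t * (X ^ 2) ^ (v + 1)))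

theorem symmTerm_comm (t : A⟦X⟧) (u v : ℕ) : symmTerm t u v = symmTerm t v u := by
  rw [symmTerm, symmTerm, add_comm u v]
  ring

theorem X_pow_dvd_symmTerm (t : A⟦X⟧) (u v : ℕ) : X ^ (u + v) ∣ symmTerm t u v :=
  Dvd.dvd.mul_right (Dvd.dvd.mul_right (Dvd.dvd.mul_left
    (pow_dvd_pow _ (Nat.le_self_pow two_ne_zero _)) _) _) _

variable [DiscreteTopology A]

theorem tsum_oddTheta (t : A⟦X⟧) : ∑' d, oddTheta Y t d = ∑' N, thetaTwo Y t N := by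
  have h := (summable_of_finite_not_X_pow_dvd (finite_oddTheta Y t)).hasSum
  rw [← injective_two_mul_sub_one.hasSum_iff fun d hd => oddTheta_eq_zero Y hd] at h
  rw [← h.tsum_eq]
  exact tsum_congr fun N => oddTheta_two_mul_sub_one Y t N

/-- Changing base to `P = -(t * X)` pulls out `eulerSeries (X ^ 2) (t * X)` twice and leaves
`hasSum_bilateral` for `oddTheta`. One of the two factors is absorbed in returning from `1 / (P;
P)_∞` to `1 / (X ^ 2; X ^ 2)_∞`. -/
theorem tsum_caseTwo {t : A⟦X⟧} (ht : t * t = 1) :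
    ∑' x : ℕ × ℕ, t ^ (x.1 + x.2) * X ^ ((x.1 + x.2) ^ 2 + (x.1 + x.2)) *
        (qfacInv (X ^ 2) x.1 * qfacInv (X ^ 2) x.2) *
        (yPow Y ((x.1 : ℤ) - x.2) + t * yPow Y (1 - ((x.1 : ℤ) - x.2))) *
        (eulerSeries (X ^ 2) (t * X * (X ^ 2) ^ x.1) *
          eulerSeries (X ^ 2) (t * X * (X ^ 2) ^ (x.2 + 1))) =
      eulerSeries (X ^ 2) (t * X) * (cauchySeries (X ^ 2) 0 * ∑' N, thetaTwo Y t N) := by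
  have h1 := hasSum_bilateral (X_dvd_neg_mul_X t) (finite_oddTheta Y t)
  rw [← oddPair_injective.hasSum_iff] at h1
  · have h2 : HasSum (fun x : ℕ × ℕ => qfacInv (-(t * X)) (2 * x.1) *
        qfacInv (-(t * X)) (2 * x.2 + 1) * (t ^ (x.1 + x.2) *
          X ^ ((x.1 + x.2) ^ 2 + (x.1 + x.2)) *
          (yPow Y ((x.1 : ℤ) - x.2) + t * yPow Y (1 - ((x.1 : ℤ) - x.2)))))
        (cauchySeries (-(t * X)) 0 * ∑' d, oddTheta Y t d) := by
      refine h1.prod_fiberwise fun x => ?_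
      rw [← oddTheta_oddPair_add Y ht]
      convert! hasSum_fintype _ using 1
      rw [Fintype.sum_bool]
      simp only [Function.comp_apply, oddPair, if_true, Bool.false_eq_true, if_false]
      ring
    have h3 := h2.mul_left (eulerSeries (X ^ 2) (t * X) ^ 2)
    rw [cauchySeries_X_sq_eq ht, ← tsum_oddTheta, ← mul_assoc, ← mul_assoc, ← sq, mul_assoc,
      ← h3.tsum_eq]
    refine tsum_congr fun x => ?_
    have h4 := qfacInv_mul_eulerSeries_even ht x.1
    have h5 := qfacInv_mul_eulerSeries_odd ht x.2
    linear_combination (t ^ (x.1 + x.2) * X ^ ((x.1 + x.2) ^ 2 + (x.1 + x.2)) *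
        (yPow Y ((x.1 : ℤ) - x.2) + t * yPow Y (1 - ((x.1 : ℤ) - x.2)))) *
      (qfacInv (X ^ 2) x.2 * eulerSeries (X ^ 2) (t * X * (X ^ 2) ^ (x.2 + 1)) * h4 +
        eulerSeries (X ^ 2) (t * X) * qfacInv (-(t * X)) (2 * x.1) * h5)
  · intro x hx
    rw [oddTheta, if_neg fun h => hx (mem_range_oddPair h), mul_zero]

/-- The generating function of the case `a = 2`, before rewriting it as products. -/
theorem hasSum_caseTwo :
    HasSum (fun k => 2 * (boundedGen Y k 1 * lengthGen Y k 1))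
      (eulerSeries (X ^ 2) (1 * X) * (cauchySeries (X ^ 2) 0 * ∑' N, thetaTwo Y 1 N) +
        eulerSeries (X ^ 2) (-1 * X) * (cauchySeries (X ^ 2) 0 * ∑' N, thetaTwo Y (-1) N)) := by
  have h : ∀ t : A⟦X⟧, t * t = 1 → HasSum (fun k => ∑ y ∈ antidiagonal k,
      ∑ a ∈ antidiagonal y.1, ∑ b ∈ antidiagonal y.2, quadTermTwo Y t a.1 b.2 a.2 b.1)
      (eulerSeries (X ^ 2) (t * X) * (cauchySeries (X ^ 2) 0 * ∑' N, thetaTwo Y t N)) := by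
    intro t ht
    rw [← tsum_caseTwo Y ht]
    exact hasSum_quadruple X_dvd_X_sq (K := fun u v => t ^ (u + v) *
      X ^ ((u + v) ^ 2 + (u + v)) * (qfacInv (X ^ 2) u * qfacInv (X ^ 2) v) *
      (yPow Y ((u : ℤ) - v) + t * yPow Y (1 - ((u : ℤ) - v))))
      (fun u v => Dvd.dvd.mul_right (Dvd.dvd.mul_right (Dvd.dvd.mul_left
        (pow_dvd_pow _ (Nat.le_add_left _ _)) _) _) _)
      (fun u => t * X * (X ^ 2) ^ u) (fun v => t * X * (X ^ 2) ^ (v + 1))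
  refine ((h 1 (one_mul 1)).add (h (-1) (by ring))).congr_fun fun k => ?_
  rw [two_mul_boundedGen_mul_lengthGen]
  simp only [Finset.sum_add_distrib]

/-- Expand `1 - q ^ (r + v)` for `q = X ^ 2`. The factor `q ^ r` shifts the Euler argument from `t *
q ^ u` to `t * q ^ (u + 1)`, and `eulerSeries_eq` brings both parts to the same Euler series, with
coefficient `1 + t * q ^ u - q ^ v`. -/
theorem hasSum_quadTermOne (t : A⟦X⟧) : HasSum (fun k => ∑ y ∈ antidiagonal k,
      ∑ a ∈ antidiagonal y.1, ∑ b ∈ antidiagonal y.2, quadTermOne Y t a.1 b.2 a.2 b.1)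
    (∑' x : ℕ × ℕ, symmTerm t x.1 x.2 *
      (yPow Y ((x.1 : ℤ) - x.2) + t * yPow Y ((x.2 : ℤ) - x.1)) *
        (1 + t * (X ^ 2) ^ x.1 - (X ^ 2) ^ x.2)) := by
  set K : ℕ → ℕ → A⟦X⟧ := fun u v => t ^ (u + v) * X ^ ((u + v) ^ 2) *
    (qfacInv (X ^ 2) u * qfacInv (X ^ 2) v) *
    (yPow Y ((u : ℤ) - v) + t * yPow Y ((v : ℤ) - u)) with hKdef
  have hK : ∀ u v, X ^ (u + v) ∣ K u v := fun u v => Dvd.dvd.mul_right (Dvd.dvd.mul_right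
    (Dvd.dvd.mul_left (pow_dvd_pow _ (Nat.le_self_pow two_ne_zero _)) _) _) _
  have hK' : ∀ u v, X ^ (u + v) ∣ K u v * (X ^ 2) ^ v := fun u v => Dvd.dvd.mul_right (hK u v) _
  have h1 := hasSum_quadruple X_dvd_X_sq hK (fun u => t * (X ^ 2) ^ u)
    (fun v => t * (X ^ 2) ^ (v + 1))
  have h2 := hasSum_quadruple X_dvd_X_sq hK' (fun u => t * (X ^ 2) ^ (u + 1))
    (fun v => t * (X ^ 2) ^ (v + 1))
  have h3 : ∑' x : ℕ × ℕ, K x.1 x.2 * (eulerSeries (X ^ 2) (t * (X ^ 2) ^ x.1) *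
        eulerSeries (X ^ 2) (t * (X ^ 2) ^ (x.2 + 1))) -
      ∑' x : ℕ × ℕ, K x.1 x.2 * (X ^ 2) ^ x.2 * (eulerSeries (X ^ 2) (t * (X ^ 2) ^ (x.1 + 1)) *
        eulerSeries (X ^ 2) (t * (X ^ 2) ^ (x.2 + 1))) =
      ∑' x : ℕ × ℕ, symmTerm t x.1 x.2 *
        (yPow Y ((x.1 : ℤ) - x.2) + t * yPow Y ((x.2 : ℤ) - x.1)) *
        (1 + t * (X ^ 2) ^ x.1 - (X ^ 2) ^ x.2) := by
    rw [← Summable.tsum_sub]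
    · refine tsum_congr fun x => ?_
      rw [eulerSeries_eq X_dvd_X_sq (t * (X ^ 2) ^ x.1), mul_assoc t, ← pow_succ, symmTerm]
      simp only [hKdef]
      ring
    · exact summable_of_X_pow_add_dvd fun u v => Dvd.dvd.mul_right (hK u v) _
    · exact summable_of_X_pow_add_dvd fun u v => Dvd.dvd.mul_right (hK' u v) _
  rw [← h3]
  refine (h1.sub h2).congr_fun fun k => ?_
  simp only [← Finset.sum_sub_distrib]
  refine Finset.sum_congr rfl fun y _ => Finset.sum_congr rfl fun a _ =>
    Finset.sum_congr rfl fun b _ => ?_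
  simp only [hKdef, quadTermOne]
  ring

/-- Exchange `u` and `v` in the second `y`-term. As `t * t = 1`, the coefficients add up to `(1 + t
* q ^ u - q ^ v) + t * (1 + t * q ^ v - q ^ u) = 1 + t`, where `q = X ^ 2`. -/
theorem tsum_symm {t : A⟦X⟧} (ht : t * t = 1) :
    ∑' x : ℕ × ℕ, symmTerm t x.1 x.2 *
      (yPow Y ((x.1 : ℤ) - x.2) + t * yPow Y ((x.2 : ℤ) - x.1)) *
        (1 + t * (X ^ 2) ^ x.1 - (X ^ 2) ^ x.2) =
      (1 + t) * ∑' x : ℕ × ℕ, symmTerm t x.1 x.2 * yPow Y ((x.1 : ℤ) - x.2) := by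
  have h1 : Summable fun x : ℕ × ℕ => symmTerm t x.1 x.2 * yPow Y ((x.1 : ℤ) - x.2) *
      (1 + t * (X ^ 2) ^ x.1 - (X ^ 2) ^ x.2) := summable_of_X_pow_add_dvd fun u v =>
    Dvd.dvd.mul_right (Dvd.dvd.mul_right (X_pow_dvd_symmTerm t u v) _) _
  have h2 : Summable fun x : ℕ × ℕ => symmTerm t x.1 x.2 * (t * yPow Y ((x.2 : ℤ) - x.1)) *
      (1 + t * (X ^ 2) ^ x.1 - (X ^ 2) ^ x.2) := summable_of_X_pow_add_dvd fun u v =>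
    Dvd.dvd.mul_right (Dvd.dvd.mul_right (X_pow_dvd_symmTerm t u v) _) _
  have h3 : Summable fun x : ℕ × ℕ => symmTerm t x.1 x.2 * yPow Y ((x.1 : ℤ) - x.2) :=
    summable_of_X_pow_add_dvd fun u v => Dvd.dvd.mul_right (X_pow_dvd_symmTerm t u v) _
  have h4 := h1.hasSum.add ((Equiv.prodComm ℕ ℕ).hasSum_iff.2 h2.hasSum)
  have h5 := h4.unique ((h3.hasSum.mul_left (1 + t)).congr_fun fun x => by
    simp only [Function.comp_apply, Equiv.prodComm_apply, Prod.fst_swap, Prod.snd_swap]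
    rw [symmTerm_comm t x.2 x.1]
    linear_combination symmTerm t x.1 x.2 * yPow Y ((x.1 : ℤ) - x.2) * (X ^ 2) ^ x.2 * ht)
  rw [← h5, ← h1.tsum_add h2]
  exact tsum_congr fun x => by ring

/-- In base `X ^ 4` this is a bilateral series, because `(u + v) ^ 2 = 4 * u * v + (u - v) ^ 2`. -/
theorem tsum_symmTerm_one : ∑' x : ℕ × ℕ, symmTerm (1 : A⟦X⟧) x.1 x.2 * yPow Y ((x.1 : ℤ) - x.2) =
    eulerSeries (X ^ 2) (X ^ 2) * (cauchySeries (X ^ 2) 0 * ∑' N, thetaOne Y N) := by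
  have hp : (X : A⟦X⟧) ∣ (X ^ 2) ^ 2 := dvd_pow X_dvd_X_sq two_ne_zero
  have h1 := (hasSum_bilateral hp (finite_thetaOne Y)).mul_left
    (eulerSeries (X ^ 2) (X ^ 2) ^ 2)
  rw [cauchySeries_eq_eulerSeries_mul X_dvd_X_sq, ← mul_assoc, ← mul_assoc, ← sq, mul_assoc,
    ← h1.tsum_eq]
  refine tsum_congr fun x => ?_
  have h2 := qfacInv_mul_eulerSeries_succ (X_dvd_X_sq (A := A)) x.1
  have h3 := qfacInv_mul_eulerSeries_succ (X_dvd_X_sq (A := A)) x.2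
  have h5 : (((X : A⟦X⟧) ^ 2) ^ 2) ^ (x.1 * x.2) * X ^ (((x.1 : ℤ) - x.2).natAbs ^ 2) =
      X ^ (x.1 + x.2) ^ 2 := by
    rw [← pow_mul, ← pow_mul, ← pow_add]
    congr 1
    zify
    rw [sq_abs]
    ring
  rw [symmTerm, thetaOne, one_pow, one_mul, one_mul, one_mul, ← h5]
  linear_combination (((X : A⟦X⟧) ^ 2) ^ 2) ^ (x.1 * x.2) *
    X ^ (((x.1 : ℤ) - x.2).natAbs ^ 2) * yPow Y ((x.1 : ℤ) - x.2) *
    (qfacInv (X ^ 2) x.2 * eulerSeries (X ^ 2) ((X ^ 2) ^ (x.2 + 1)) * h2 +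
      eulerSeries (X ^ 2) (X ^ 2) * qfacInv ((X ^ 2) ^ 2) x.1 * h3)

/-- The generating function of the case `a = 1`, before rewriting it as products. -/
theorem hasSum_caseOne :
    HasSum (fun k => 2 * (boundedGen Y (k + 1) 1 * lengthGen Y k (-1)))
      (2 * (eulerSeries (X ^ 2) (X ^ 2) * (cauchySeries (X ^ 2) 0 * ∑' N, thetaOne Y N))) := by
  have h1 := (hasSum_quadTermOne Y 1).add (hasSum_quadTermOne Y (-1))
  -- The series for `t = -1` vanishes through `1 + t`. The index shift is free: at total `0` the
  -- factor `1 - q ^ (r + v)` is zero.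
  rw [tsum_symm Y (one_mul 1), tsum_symm Y (by ring), tsum_symmTerm_one, add_neg_cancel, zero_mul,
    add_zero, one_add_one_eq_two, ← hasSum_nat_add_iff' 1] at h1
  simp only [Finset.range_one, Finset.sum_singleton, Finset.HasAntidiagonal.antidiagonal_zero, quadTermOne,
    add_zero, pow_zero, sub_self, mul_zero, zero_mul, sub_zero] at h1
  refine h1.congr_fun fun k => ?_
  rw [two_mul_boundedGen_succ_mul_lengthGen]
  simp only [Finset.sum_add_distrib, quadTermOne]

end DoubleSums

/-! ### Converting Euler, Cauchy and theta series into infinite products. -/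

section InfiniteProducts

variable {A : Type*} [CommRing A] (Y : Aˣ) [TopologicalSpace A] [DiscreteTopology A]

theorem hasProd_one_sub : HasProd (fun n : ℕ => 1 - (X : A⟦X⟧) ^ (2 * n + 2))
    (eulerSeries (X ^ 2) (-X ^ 2)) := by
  refine (hasProd_one_add_mul_pow X_dvd_X_sq (-X ^ 2)).congr_fun fun n => ?_
  ring

/-- Convergence is checked separately; the value follows because this product and `cauchySeries (X ^
2) 0` are both inverse to `eulerSeries (X ^ 2) (-X ^ 2)`. -/
theorem hasProd_invOfUnit_one_sub :
    HasProd (fun n : ℕ => PowerSeries.invOfUnit (1 - (X : A⟦X⟧) ^ (2 * n + 2)) 1)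
      (cauchySeries (X ^ 2) 0) := by
  have h1 : ∀ n : ℕ, (1 - (X : A⟦X⟧) ^ (2 * n + 2)) *
      PowerSeries.invOfUnit (1 - X ^ (2 * n + 2)) 1 = 1 := fun n =>
    PowerSeries.mul_invOfUnit _ 1 (by simp)
  have h2 : Multipliable fun n : ℕ => PowerSeries.invOfUnit (1 - (X : A⟦X⟧) ^ (2 * n + 2)) 1 := by
    have h3 : (fun n : ℕ => PowerSeries.invOfUnit (1 - (X : A⟦X⟧) ^ (2 * n + 2)) 1) = fun n : ℕ =>
        1 + X ^ (2 * n + 2) * PowerSeries.invOfUnit (1 - (X : A⟦X⟧) ^ (2 * n + 2)) 1 := by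
      funext n
      linear_combination h1 n
    rw [h3]
    refine multipliable_one_add_of_X_pow_dvd fun n => Dvd.dvd.mul_right (pow_dvd_pow _ ?_) _
    lia
  have h4 := (hasProd_one_sub (A := A)).mul h2.hasProd
  simp only [h1] at h4
  have h5 := h4.unique hasProd_one
  have h6 := cauchySeries_mul_eulerSeries (X_dvd_X_sq (A := A)) 0
  have h7 : ∏' n : ℕ, PowerSeries.invOfUnit (1 - (X : A⟦X⟧) ^ (2 * n + 2)) 1 =
      cauchySeries (X ^ 2) 0 := by
    linear_combination cauchySeries (X ^ 2) 0 * h5 -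
      (∏' n : ℕ, PowerSeries.invOfUnit (1 - (X : A⟦X⟧) ^ (2 * n + 2)) 1) * h6
  rw [← h7]
  exact h2.hasProd

theorem hasProd_one_add_X_pow_even_div :
    HasProd (fun n : ℕ => (1 + (X : A⟦X⟧) ^ (2 * n + 2)) *
      PowerSeries.invOfUnit (1 - X ^ (2 * n + 2)) 1)
      (eulerSeries (X ^ 2) (X ^ 2) * cauchySeries (X ^ 2) 0) := by
  refine HasProd.mul ?_ hasProd_invOfUnit_one_sub
  refine (hasProd_one_add_mul_pow X_dvd_X_sq (X ^ 2)).congr_fun fun n => ?_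
  ring

theorem hasProd_one_add_X_pow_odd_div (t : A⟦X⟧) :
    HasProd (fun n : ℕ => (1 + t * (X : A⟦X⟧) ^ (2 * n + 1)) *
      PowerSeries.invOfUnit (1 - X ^ (2 * n + 2)) 1)
      (eulerSeries (X ^ 2) (t * X) * cauchySeries (X ^ 2) 0) := by
  refine HasProd.mul ?_ hasProd_invOfUnit_one_sub
  refine (hasProd_one_add_mul_pow X_dvd_X_sq (t * X)).congr_fun fun n => ?_
  ring

theorem hasProd_thetaOne :
    HasProd (fun n : ℕ => (1 + yPow Y 1 * X ^ (2 * n + 1)) * (1 + yPow Y (-1) * X ^ (2 * n + 1)) *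
      (1 - X ^ (2 * n + 2))) (∑' N, thetaOne Y N) := by
  have h1 : ∑' N, thetaOne Y N = eulerSeries (X ^ 2) (yPow Y 1 * X) *
      eulerSeries (X ^ 2) (yPow Y (-1) * X) * eulerSeries (X ^ 2) (-X ^ 2) := by
    rw [eulerSeries_mul_eulerSeries_thetaOne]
    linear_combination (-∑' N, thetaOne Y N) * cauchySeries_mul_eulerSeries (X_dvd_X_sq (A := A)) 0
  rw [h1]
  refine HasProd.mul (HasProd.mul ?_ ?_) hasProd_one_sub
  · exact (hasProd_one_add_mul_pow X_dvd_X_sq (yPow Y 1 * X)).congr_fun fun n => by ring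
  · exact (hasProd_one_add_mul_pow X_dvd_X_sq (yPow Y (-1) * X)).congr_fun fun n => by ring

theorem hasProd_thetaTwo {t : A⟦X⟧} (ht : t * t = 1) :
    HasProd (fun n : ℕ => (1 + t * (yPow Y 1 * X ^ (2 * n))) *
      (1 + t * (yPow Y (-1) * X ^ (2 * n + 2))) * (1 - X ^ (2 * n + 2)))
      (∑' N, thetaTwo Y t N) := by
  have h1 : ∑' N, thetaTwo Y t N = eulerSeries (X ^ 2) (t * yPow Y 1) *
      eulerSeries (X ^ 2) (t * yPow Y (-1) * X ^ 2) * eulerSeries (X ^ 2) (-X ^ 2) := by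
    rw [eulerSeries_mul_eulerSeries_thetaTwo Y ht]
    linear_combination (-∑' N, thetaTwo Y t N) *
      cauchySeries_mul_eulerSeries (X_dvd_X_sq (A := A)) 0
  rw [h1]
  refine HasProd.mul (HasProd.mul ?_ ?_) hasProd_one_sub
  · exact (hasProd_one_add_mul_pow X_dvd_X_sq (t * yPow Y 1)).congr_fun fun n => by ring
  · exact (hasProd_one_add_mul_pow X_dvd_X_sq (t * yPow Y (-1) * X ^ 2)).congr_fun fun n => by ring

end InfiniteProducts

theorem y_eq_yPow : y = yPow yUnit 1 := by rw [y, yPow, yUnit_zpow]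

theorem yInv_eq_yPow : yInv = yPow yUnit (-1) := by rw [yInv, yPow, yUnit_zpow]

/-! ### Closed forms of the two generating functions. -/

section GenFunEval

theorem two_mul_cancel {f g : ℚ[T;T⁻¹]⟦X⟧} (h : 2 * f = 2 * g) : f = g := by
  have h2 : ∀ f : ℚ[T;T⁻¹]⟦X⟧, f = (1 / 2 : ℚ) • (2 * f) := fun f => by
    rw [two_mul, ← two_smul ℚ f, smul_smul]
    norm_num
  rw [h2 f, h, ← h2 g]

variable [TopologicalSpace ℚ[T;T⁻¹]] [DiscreteTopology ℚ[T;T⁻¹]]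

theorem genFun_one_eq : genFun 1 2 = eulerSeries (X ^ 2) (X ^ 2) * cauchySeries (X ^ 2) 0 *
    ∑' N, thetaOne yUnit N := by
  have h := (hasSum_genFun_one.mul_left 2).unique (hasSum_caseOne yUnit)
  rw [mul_assoc]
  exact two_mul_cancel h

theorem genFun_two_eq : genFun 2 2 = (1 / 2 : ℚ) •
    (eulerSeries (X ^ 2) (1 * X) * cauchySeries (X ^ 2) 0 * ∑' N, thetaTwo yUnit 1 N +
      eulerSeries (X ^ 2) (-1 * X) * cauchySeries (X ^ 2) 0 * ∑' N, thetaTwo yUnit (-1) N) := by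
  have h := (hasSum_genFun_two.mul_left 2).unique (hasSum_caseTwo yUnit)
  rw [mul_assoc, mul_assoc, ← h, two_mul, ← two_smul ℚ (genFun 2 2), smul_smul]
  norm_num

end GenFunEval

end ArikiKoike

open ArikiKoike in
theorem mainTheorem2 [TopologicalSpace ℚ[T;T⁻¹]] [DiscreteTopology ℚ[T;T⁻¹]] :
    -- all infinite products below converge (indices are shifted: `n` here is `n - 1` in `∏_{n ≥ 1}`)
    (Multipliable fun n : ℕ => (1 + x ^ (2 * n + 2)) * recip (1 - x ^ (2 * n + 2))) ∧
    (Multipliable fun n : ℕ =>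
      (1 + y * x ^ (2 * n + 1)) * (1 + yInv * x ^ (2 * n + 1)) * (1 - x ^ (2 * n + 2))) ∧
    (Multipliable fun n : ℕ => (1 + x ^ (2 * n + 1)) * recip (1 - x ^ (2 * n + 2))) ∧
    (Multipliable fun n : ℕ =>
      (1 + y * x ^ (2 * n)) * (1 + yInv * x ^ (2 * n + 2)) * (1 - x ^ (2 * n + 2))) ∧
    (Multipliable fun n : ℕ => (1 - x ^ (2 * n + 1)) * recip (1 - x ^ (2 * n + 2))) ∧
    (Multipliable fun n : ℕ =>
      (1 - y * x ^ (2 * n)) * (1 - yInv * x ^ (2 * n + 2)) * (1 - x ^ (2 * n + 2))) ∧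
    -- the case `a = 1`
    genFun 1 2 =
      (∏' n : ℕ, (1 + x ^ (2 * n + 2)) * recip (1 - x ^ (2 * n + 2))) *
      (∏' n : ℕ,
        (1 + y * x ^ (2 * n + 1)) * (1 + yInv * x ^ (2 * n + 1)) * (1 - x ^ (2 * n + 2))) ∧
    -- the case `a = 2`
    genFun 2 2 =
      (1 / 2 : ℚ) •
        ((∏' n : ℕ, (1 + x ^ (2 * n + 1)) * recip (1 - x ^ (2 * n + 2))) *
          (∏' n : ℕ,
            (1 + y * x ^ (2 * n)) * (1 + yInv * x ^ (2 * n + 2)) * (1 - x ^ (2 * n + 2))) +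
        (∏' n : ℕ, (1 - x ^ (2 * n + 1)) * recip (1 - x ^ (2 * n + 2))) *
          (∏' n : ℕ,
            (1 - y * x ^ (2 * n)) * (1 - yInv * x ^ (2 * n + 2)) * (1 - x ^ (2 * n + 2)))) := by
  have h1 := hasProd_one_add_X_pow_even_div (A := ℚ[T;T⁻¹])
  have h2 := hasProd_thetaOne yUnit
  have h3 := hasProd_one_add_X_pow_odd_div (A := ℚ[T;T⁻¹]) 1
  have h4 := hasProd_thetaTwo yUnit (t := 1) (one_mul 1)
  have h5 := hasProd_one_add_X_pow_odd_div (A := ℚ[T;T⁻¹]) (-1)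
  have h6 := hasProd_thetaTwo yUnit (t := -1) (by rw [neg_mul_neg, one_mul])
  rw [genFun_one_eq, genFun_two_eq]
  simp only [one_mul, neg_mul, ← sub_eq_add_neg, ← y_eq_yPow, ← yInv_eq_yPow] at h1 h2 h3 h4 h5 h6 ⊢
  refine ⟨h1.multipliable, h2.multipliable, h3.multipliable, h4.multipliable, h5.multipliable,
    h6.multipliable, ?_, ?_⟩
  · exact (congrArg₂ (· * ·) h1.tprod_eq h2.tprod_eq).symm
  · refine congrArg ((1 / 2 : ℚ) • ·) (congrArg₂ (· + ·) ?_ ?_)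
    · exact (congrArg₂ (· * ·) h3.tprod_eq h4.tprod_eq).symm
    · exact (congrArg₂ (· * ·) h5.tprod_eq h6.tprod_eq).symm
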